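/- For a finite group $G$, let $\mathrm{rk}(G)$ be the largest $r$ such that $G$ has a subgroup isomorphic to $(\mathbb{Z}/p)^r$ for some prime $p$. Let $p$ be a prime and $G_p$ a Sylow $p$-subgroup of $G$. A character $\chi$ of a complex representation of $G_p$ of positive finite dimension is called a \emph{$p$-effective character of $G$} if (i) $\chi(h)=\chi(k)$ whenever $h,k\in G_p$ are conjugate in $G$, and (ii) for every elementary abelian subgroup $E\subseteq G_p$ of rank $\mathrm{rk}(G)$ the restriction $\chi|_E$ does not contain the trivial character of $E$, i.e. $[\chi|_E,1_E]=0$. A 2-group is called \emph{semi-dihedral} if it has a presentation $\langle x,y\mid x^{2^n}=y^2=1,\ yxy^{-1}=x^{-1+2^{n-1}}\rangle$ with $n\ge 3$, and \emph{wreathed} if it has a presentation $\langle x,y,z\mid x^{2^n}=y^{2^n}=z^2=1,\ xy=yx,\ zxz^{-1}=y\rangle$ with $n\ge 2$; dihedral 2-groups are those of order at least $4$, the Klein four-group being included. \textbf{Proposition.} Let $G$ be a finite group with $\mathrm{rk}(G)=2$ and let $G_2$ be a Sylow 2-subgroup of $G$. If $G_2$ is dihedral, semi-dihedral or wreathed,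 then there is a character of $G_2$ that is a 2-effective character of $G$. If $G_2$ is dihedral or semi-dihedral, then such a character can moreover be chosen to be constant on elements of $G_2$ of the same order. -/

import Mathlib

namespace EffChar

/-- `E` is an elementary abelian `p`-group of rank `r`, that is, `E` is isomorphic to `(ℤ/p)^r`
(`p` is a prime wherever this is used). -/
def IsElementaryAbelian (p r : ℕ) (E : Type*) [Group E] : Prop :=
  (∀ x y : E, x * y = y * x) ∧ (∀ x : E, x ^ p = 1) ∧ Nat.card E = p ^ r

/-- The rank `rk(G)` of a finite group `G`: the largest rank of an elementary abelian `p`-subgroup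
of `G`, over all primes `p`. -/
noncomputable def rk (G : Type*) [Group G] : ℕ :=
  sSup {r : ℕ | ∃ p : ℕ, p.Prime ∧ ∃ E : Subgroup G, IsElementaryAbelian p r E}

/-- `χ` is the character of a finite-dimensional complex representation of `H` of positive
degree. -/
def IsCharacter {H : Type*} [Group H] (χ : H → ℂ) : Prop :=
  ∃ n : ℕ, 0 < n ∧ ∃ ρ : Representation ℂ H (Fin n → ℂ), ∀ h : H, χ h = LinearMap.trace ℂ _ (ρ h)

/-- The inner product `[φ, ψ] = |H|⁻¹ ∑ φ(h) conj(ψ(h))` of complex functions on a finite group. -/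
noncomputable def charInner {H : Type*} [Group H] (φ ψ : H → ℂ) : ℂ :=
  (Nat.card H : ℂ)⁻¹ * ∑ᶠ h : H, φ h * (starRingEnd ℂ) (ψ h)

/-- `χ : H → ℂ` respects fusion in `G`: it takes the same value at elements of `H` that are
conjugate in `G`. -/
def RespectsFusion {G : Type*} [Group G] (H : Subgroup G) (χ : H → ℂ) : Prop :=
  ∀ h k : H, IsConj (h : G) (k : G) → χ h = χ k

/-- `χ` is a `p`-effective character of `G`, for the Sylow `p`-subgroup `P`: a character of `P` that
respects fusion in `G` and whose restriction to every elementary abelian subgroup of `P` of rank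
`rk(G)` does not contain the trivial character. -/
def IsEffectiveCharacter {G : Type*} [Group G] (p : ℕ) (P : Sylow p G) (χ : P → ℂ) : Prop :=
  IsCharacter χ ∧ RespectsFusion (P : Subgroup G) χ ∧
    ∀ E : Subgroup P, IsElementaryAbelian p (rk G) E →
      charInner (fun e : E => χ (e : P)) (fun _ : E => 1) = 0

/-- Dihedral 2-groups, of order `2 ^ (n + 1) ≥ 4`. -/
def IsDihedralTwoGroup (P : Type*) [Group P] : Prop :=
  ∃ n : ℕ, 1 ≤ n ∧ Nonempty (P ≃* DihedralGroup (2 ^ n))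

/-- Semi-dihedral 2-groups
`⟨x, y | x ^ (2 ^ n) = y ^ 2 = 1, y * x * y⁻¹ = x ^ (-1 + 2 ^ (n - 1))⟩`, `n ≥ 3`.
These relations present a group of order `2 ^ (n + 1)`, so requiring that order says that they are
defining relations. -/
def IsSemidihedralTwoGroup (P : Type*) [Group P] : Prop :=
  ∃ n : ℕ, 3 ≤ n ∧ Nat.card P = 2 ^ (n + 1) ∧
    ∃ x y : P, Subgroup.closure {x, y} = ⊤ ∧ x ^ (2 ^ n) = 1 ∧ y ^ 2 = 1 ∧
      y * x * y⁻¹ = x ^ (-1 + 2 ^ (n - 1) : ℤ)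

/-- Wreathed 2-groups
`⟨x, y, z | x ^ (2 ^ n) = y ^ (2 ^ n) = z ^ 2 = 1, x * y = y * x, z * x * z⁻¹ = y⟩`, `n ≥ 2`.
These relations present a group of order `2 ^ (2 * n + 1)` (the wreath product of `ℤ/2ⁿ` by `ℤ/2`),
so requiring that order says that they are defining relations. -/
def IsWreathedTwoGroup (P : Type*) [Group P] : Prop :=
  ∃ n : ℕ, 2 ≤ n ∧ Nat.card P = 2 ^ (2 * n + 1) ∧
    ∃ x y z : P, Subgroup.closure {x, y, z} = ⊤ ∧
      x ^ (2 ^ n) = 1 ∧ y ^ (2 ^ n) = 1 ∧ z ^ 2 = 1 ∧ x * y = y * x ∧ z * x * z⁻¹ = y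

end EffChar

namespace EffChar

open Finset

/-! Since the rank is 2, it suffices to find a fusion-invariant character of `P` with value `3m` at
1 and `-m` at every involution: its values then sum to zero over each Klein four-group. The
characters are built from linear characters of subgroups, by induction up to a positive multiple.

Dihedral and semi-dihedral case: let `z` be the central involution, `f` the function equal to 1 at
1, -1 at `z` and 0 elsewhere, and `l` a linear character with `l z = 1` and value -1 on the other
involutions. Then `|P| * (2f + l)` has the right values. On elements of order greater than 2 it is a
multiple of `l`, and `l` can be chosen to depend only on the order there; conjugate elements have
equal order, so fusion is respected (`exists_isEffectiveCharacter_of_sign`).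

Wreathed case: let `A` be the homocyclic base group, with coordinates `v = (v.1, v.2)`, and let `R`
be `ramanujan`. The character is `|P| * (R(v.1 + v.2) + R(l v) + R(l v.swap))` on `A` and `-|P| *
R(v.1 + v.2)` on the outer coset, for a suitable additive map `l`. Fusion splits into three cases.
Inside `A`, fusion is induced by the normalizer of `A`, because `A` is the only abelian subgroup of
its order in `P` (`exists_actsBy_of_fusion`). The automorphisms so induced are determined by their
action on the three involutions of `A` (`actsBy_eq_refl`), hence form a group of order 2 or a copy
of `S₃`; `l` is chosen accordingly (`exists_weight`). Outer elements square to diagonal elements of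
`A`, and the squares determine the value. For an outer element conjugate to an element of `A`,
squares again suffice, except for one configuration of elements of order 4, which `not_conj_of_sq`
excludes. -/

/-! ### Constructing characters -/

theorem isCharacter_trace {H V : Type*} [Group H] [AddCommGroup V] [Module ℂ V]
    [FiniteDimensional ℂ V] [Nontrivial V] (ρ : Representation ℂ H V) :
    IsCharacter (fun h => LinearMap.trace ℂ V (ρ h)) := by
  let e : V ≃ₗ[ℂ] (Fin (Module.finrank ℂ V) → ℂ) :=
    (Module.finBasis ℂ V).equivFun
  refine ⟨Module.finrank ℂ V, Module.finrank_pos,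
    { toFun := fun h => e.conj (ρ h)
      map_one' := by
        rw [map_one]; exact LinearEquiv.conj_id e
      map_mul' := fun g h => by
        rw [map_mul]; exact LinearEquiv.conj_comp e _ _ }, fun h => ?_⟩
  exact (LinearMap.trace_conj' (ρ h) e).symm

theorem isCharacter_add {H : Type*} [Group H] {φ ψ : H → ℂ} (hφ : IsCharacter φ)
    (hψ : IsCharacter ψ) : IsCharacter (fun h => φ h + ψ h) := by
  obtain ⟨m, hm, ρ, hρ⟩ := hφ
  obtain ⟨n, hn, τ, hτ⟩ := hψ
  have : NeZero m := ⟨hm.ne'⟩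
  have := isCharacter_trace (Representation.prod ρ τ)
  convert this using 2 with h
  rw [hρ, hτ]
  exact (LinearMap.trace_prodMap' (ρ h) (τ h)).symm

theorem isCharacter_nsmul {H : Type*} [Group H] {φ : H → ℂ} (hφ : IsCharacter φ) {n : ℕ}
    (hn : 0 < n) : IsCharacter (fun h => (n : ℂ) * φ h) := by
  induction n, hn using Nat.le_induction with
  | base => simpa using hφ
  | succ k _ ih =>
    convert isCharacter_add ih hφ using 2
    push_cast; ring

/-- The range `W` of `e` is a subrepresentation on which `e` acts as the scalar `m`. Factoring `e`
through `W` and using cyclicity of the trace gives `m` times the character of `W`. -/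
theorem isCharacter_of_quasiIdempotent {H V : Type*} [Group H] [AddCommGroup V] [Module ℂ V]
    [FiniteDimensional ℂ V] (ρ : Representation ℂ H V) (e : V →ₗ[ℂ] V) (he0 : e ≠ 0)
    {m : ℕ} (hm : 0 < m) (he : ∀ v, e (e v) = (m : ℂ) • e v)
    (hc : ∀ h v, ρ h (e v) = e (ρ h v)) :
    IsCharacter (fun h => LinearMap.trace ℂ V (ρ h ∘ₗ e)) := by
  let W := LinearMap.range e
  have hW : ∀ h, ∀ w ∈ W, ρ h w ∈ W := by
    rintro h _ ⟨v, rfl⟩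
    exact ⟨ρ h v, (hc h v).symm⟩
  let ρW : Representation ℂ H W :=
    { toFun := fun h => (ρ h).restrict (hW h)
      map_one' := by ext; simp
      map_mul' := fun g h => by ext; simp }
  have : Nontrivial W := by
    rw [Submodule.nontrivial_iff_ne_bot]
    simpa [W, LinearMap.range_eq_bot] using he0
  convert isCharacter_nsmul (isCharacter_trace ρW) hm using 2 with h
  have h1 : ρ h ∘ₗ e = (W.subtype ∘ₗ ρW h) ∘ₗ e.rangeRestrict := by
    ext v; rfl
  have h2 : e.rangeRestrict ∘ₗ (W.subtype ∘ₗ ρW h) = (m : ℂ) • ρW h := by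
    ext ⟨_, v, rfl⟩
    change e (ρ h (e v)) = (m : ℂ) • ρ h (e v)
    rw [← hc, he, map_smul]
  rw [h1, LinearMap.trace_comp_comm', h2, map_smul, smul_eq_mul]

/-- The sum of the conjugates of a function that vanishes off a subgroup and is a linear character
on that subgroup: a multiple of the induced character. -/
theorem isCharacter_sum_conj {H : Type*} [Group H] [Fintype H] {f : H → ℂ} (h1 : f 1 = 1)
    (hf : ∀ g h, f g ≠ 0 → f (g * h) = f g * f h) :
    IsCharacter (fun g => ∑ t, f (t⁻¹ * g * t)) := by
  classical
  let ρ : Representation ℂ H (H → ℂ) :=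
    { toFun := fun g => LinearMap.funLeft ℂ ℂ (fun p => g⁻¹ * p)
      map_one' := by ext; simp [LinearMap.funLeft]
      map_mul' := fun g h => by
        ext; simp [LinearMap.funLeft, mul_assoc] }
  have hρ : ∀ g φ p, ρ g φ p = φ (g⁻¹ * p) := fun g φ p => rfl
  -- Right convolution with `f` commutes with left translation. It is quasi-idempotent, with factor
  -- the order of the subgroup on which `f` does not vanish.
  let e : (H → ℂ) →ₗ[ℂ] (H → ℂ) :=
    { toFun := fun φ p => ∑ h, f h * φ (p * h)
      map_add' := fun φ ψ => by ext p; simp [mul_add, Finset.sum_add_distrib]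
      map_smul' := fun c φ => by
        ext p; simp only [Pi.smul_apply, smul_eq_mul, Finset.mul_sum, RingHom.id_apply]
        exact Finset.sum_congr rfl fun _ _ => by ring }
  have he : ∀ φ p, e φ p = ∑ h, f h * φ (p * h) := fun φ p => rfl
  have hm : 0 < #{h | f h ≠ 0} := Finset.card_pos.mpr ⟨1, by simp [h1]⟩
  have key := isCharacter_of_quasiIdempotent ρ e ?_ hm ?_ ?_
  · convert key using 2 with g
    rw [LinearMap.trace_eq_matrix_trace ℂ (Pi.basisFun ℂ H), Matrix.trace]
    refine Finset.sum_congr rfl fun t _ => ?_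
    rw [Matrix.diag_apply, LinearMap.toMatrix_apply]
    simp only [Pi.basisFun_apply, Pi.basisFun_repr, LinearMap.comp_apply, hρ, he]
    rw [Finset.sum_eq_single (t⁻¹ * g * t)]
    · rw [show g⁻¹ * t * (t⁻¹ * g * t) = t by group]; simp
    · intro h _ hne
      rw [Pi.single_eq_of_ne, mul_zero]
      intro h0
      rw [eq_inv_mul_of_mul_eq h0] at hne
      apply hne; group
    · simp
  · intro h0
    have := congrFun (LinearMap.congr_fun h0 (Pi.single 1 1)) 1
    rw [he, Finset.sum_eq_single 1] at this
    · simp [h1] at this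
    · intro b _ hb; simp [hb]
    · simp
  · intro φ
    ext p
    rw [Pi.smul_apply, he, he, smul_eq_mul]
    have : ∀ h, f h * e φ (p * h) = if f h ≠ 0 then ∑ k, f k * φ (p * k) else 0 := by
      intro h
      split_ifs with hh
      · rw [he, ← Equiv.sum_comp (Equiv.mulLeft h) (fun k => f k * φ (p * k)), Finset.mul_sum]
        refine Finset.sum_congr rfl fun k _ => ?_
        rw [Equiv.coe_mulLeft, hf h k hh, mul_assoc, mul_assoc]
      · rw [not_not.mp hh, zero_mul]
    rw [Finset.sum_congr rfl fun h _ => this h, ← Finset.sum_filter, Finset.sum_const,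
      nsmul_eq_mul]
  · intro g φ
    ext p
    simp only [hρ, he, mul_assoc]

/-! ### Effectiveness from the values at involutions -/

/-- A Klein four-group has three involutions, so the sum of the values is `3m - 3m`. -/
theorem charInner_one_eq_zero {H : Type*} [Group H] {χ : H → ℂ} {m : ℂ} (h1 : χ 1 = 3 * m)
    (h2 : ∀ g, g ^ 2 = 1 → g ≠ 1 → χ g = -m) (E : Subgroup H) (hE : IsElementaryAbelian 2 2 E) :
    charInner (fun e : E => χ (e : H)) (fun _ : E => 1) = 0 := by
  classical
  obtain ⟨-, hsq, hcard⟩ := hE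
  have : Finite E := Nat.finite_of_card_ne_zero (by rw [hcard]; norm_num)
  have := Fintype.ofFinite E
  rw [Nat.card_eq_fintype_card] at hcard
  have hv : ∀ e : E, χ (e : H) * (starRingEnd ℂ) 1 = -m + if e = 1 then 4 * m else 0 := by
    intro e
    rw [map_one, mul_one]
    split_ifs with he
    · rw [he, Subgroup.coe_one, h1]; ring
    · rw [add_zero]
      refine h2 _ ?_ fun h => he (Subtype.ext h)
      have := congrArg (Subtype.val) (hsq e)
      simpa using this
  rw [charInner, finsum_eq_sum_of_fintype, Finset.sum_congr rfl fun e _ => hv e,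
    Finset.sum_add_distrib]
  simp [hcard]

theorem isEffectiveCharacter_of_values {G : Type*} [Group G] (hrk : rk G = 2) (P : Sylow 2 G)
    {χ : P → ℂ} (hχ : IsCharacter χ) (hfus : RespectsFusion (P : Subgroup G) χ) {m : ℂ}
    (h1 : χ 1 = 3 * m) (h2 : ∀ g, g ^ 2 = 1 → g ≠ 1 → χ g = -m) :
    IsEffectiveCharacter 2 P χ :=
  ⟨hχ, hfus, fun E hE => charInner_one_eq_zero h1 h2 E (by rwa [hrk] at hE)⟩

/-! ### Dihedral and semi-dihedral Sylow subgroups -/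

theorem exists_isEffectiveCharacter_of_sign {G : Type*} [Group G] [Finite G] (hrk : rk G = 2)
    (P : Sylow 2 G) (z : P) (hz : ∀ g, g * z = z * g) (hz1 : z ≠ 1) (hz2 : z ^ 2 = 1)
    (l : P →* ℂ) (hlz : l z = 1) (hl : ∀ g, g ^ 2 = 1 → g ≠ 1 → g ≠ z → l g = -1)
    (hord : ∀ g h, orderOf g = orderOf h → g ^ 2 ≠ 1 → l g = l h) :
    ∃ χ : P → ℂ, IsEffectiveCharacter 2 P χ ∧ ∀ g h : P, orderOf g = orderOf h → χ g = χ h := by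
  classical
  have := Fintype.ofFinite P
  let f : P → ℂ := fun g => if g = 1 then 1 else if g = z then -1 else 0
  have f1 : f 1 = 1 := if_pos rfl
  have fz : f z = -1 := by simp [f, hz1]
  have f0 : ∀ g, g ≠ 1 → g ≠ z → f g = 0 := fun g h h' => by simp [f, h, h']
  have hzz : z * z = 1 := by rw [← pow_two, hz2]
  have hf : ∀ g h, f g ≠ 0 → f (g * h) = f g * f h := by
    intro g h hg
    by_cases hg1 : g = 1
    · simp [hg1, f1]
    by_cases hgz : g = z
    · subst hgz
      by_cases h1 : h = 1
      · simp [h1, f1]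
      by_cases h2 : h = g
      · rw [h2, hzz, fz, f1]; norm_num
      · rw [f0 h h1 h2, f0 (g * h), mul_zero]
        · intro h3; exact h2 (mul_left_cancel (h3.trans hzz.symm))
        · intro h3; exact h1 (mul_eq_left.mp h3)
    · exact absurd (f0 g hg1 hgz) hg
  -- Both `f` and `l` are class functions, so summing over conjugates multiplies them by `|P|`. The
  -- values of `2f + l` are 3 at 1, `-2 + 1` at `z`, and -1 at the other involutions.
  have hχ := isCharacter_add (isCharacter_nsmul (isCharacter_sum_conj f1 hf) zero_lt_two)
    (isCharacter_sum_conj (f := l) (map_one l) fun g h _ => map_mul l g h)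
  have hfc : ∀ g t, f (t⁻¹ * g * t) = f g := by
    intro g t
    have e1 : t⁻¹ * g * t = 1 ↔ g = 1 := by
      constructor
      · intro h
        have : g = t * (t⁻¹ * g * t) * t⁻¹ := by group
        rw [this, h]; group
      · rintro rfl; group
    have e2 : t⁻¹ * g * t = z ↔ g = z := by
      constructor
      · intro h
        have : g = t * (t⁻¹ * g * t) * t⁻¹ := by group
        rw [this, h, hz]; group
      · rintro rfl; rw [mul_assoc, ← hz]; group
    simp only [f, e1, e2]
  have hlc : ∀ g t, l (t⁻¹ * g * t) = l g := by
    intro g t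
    rw [map_mul, map_mul, mul_right_comm, ← map_mul, inv_mul_cancel, map_one, one_mul]
  simp only [hfc, hlc, Finset.sum_const, nsmul_eq_mul] at hχ
  have hsq : ∀ g : P, g ^ 2 = 1 → g ≠ 1 →
      ((2 : ℕ) : ℂ) * (#(univ : Finset P) * f g) + #(univ : Finset P) * l g
        = -#(univ : Finset P) := by
    intro g hg hg1
    by_cases hgz : g = z
    · rw [hgz, fz, hlz]; push_cast; ring
    · rw [f0 g hg1 hgz, hl g hg hg1 hgz]; ring
  have hcon : ∀ g h : P, orderOf g = orderOf h →
      ((2 : ℕ) : ℂ) * (#(univ : Finset P) * f g) + #(univ : Finset P) * l g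
        = ((2 : ℕ) : ℂ) * (#(univ : Finset P) * f h) + #(univ : Finset P) * l h := by
    intro g h hgh
    by_cases hg1 : g = 1
    · rw [hg1, orderOf_one] at hgh
      rw [hg1, orderOf_eq_one_iff.mp hgh.symm]
    by_cases hg : g ^ 2 = 1
    · have hh : h ^ 2 = 1 := by
        rw [← orderOf_dvd_iff_pow_eq_one, ← hgh, orderOf_dvd_iff_pow_eq_one, hg]
      have hh1 : h ≠ 1 := fun h1 => hg1 (by rw [← orderOf_eq_one_iff, hgh, h1, orderOf_one])
      rw [hsq g hg hg1, hsq h hh hh1]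
    · have hh : h ^ 2 ≠ 1 := fun h0 => hg (by
        rwa [← orderOf_dvd_iff_pow_eq_one, hgh, orderOf_dvd_iff_pow_eq_one])
      rw [f0 g hg1 fun h0 => hg (h0 ▸ hz2), hord g h hgh hg, f0 h (fun h0 => hh (by simp [h0]))
        fun h0 => hh (h0 ▸ hz2)]
  refine ⟨_, isEffectiveCharacter_of_values hrk P hχ (fun h k hhk => hcon h k ?_) ?_ hsq, hcon⟩
  · rw [← Subgroup.orderOf_coe, ← Subgroup.orderOf_coe]
    obtain ⟨c, hc⟩ := isConj_iff.mp hhk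
    rw [← hc]
    exact ((MulAut.conj c).orderOf_eq (h : G)).symm
  · rw [f1, map_one]; push_cast; ring

/-- The element of order two of `ZMod (2 ^ (m + 1))`. -/
def half (m : ℕ) : ZMod (2 ^ (m + 1)) := ((2 ^ m : ℕ) : ZMod (2 ^ (m + 1)))

theorem half_add_half (m : ℕ) : half m + half m = 0 := by
  rw [half, ← Nat.cast_add, ← two_mul, ← pow_succ']; exact ZMod.natCast_self _

theorem half_ne_zero (m : ℕ) : half m ≠ 0 := by
  rw [half, Ne, ZMod.natCast_eq_zero_iff]
  exact fun h => absurd (Nat.le_of_dvd (by positivity) h) (by simp [pow_succ])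

theorem eq_zero_or_half_of_add_self {m : ℕ} {v : ZMod (2 ^ (m + 1))} (hv : v + v = 0) :
    v = 0 ∨ v = half m := by
  obtain ⟨k, hk, rfl⟩ : ∃ k < 2 ^ (m + 1), v = (k : ℕ) :=
    ⟨v.val, ZMod.val_lt v, (ZMod.natCast_zmod_val v).symm⟩
  rw [← Nat.cast_add, ZMod.natCast_eq_zero_iff] at hv
  obtain ⟨j, hj⟩ := hv
  have h2 : 2 ^ (m + 1) = 2 * 2 ^ m := pow_succ' 2 m
  have hj2 : j < 2 := by
    by_contra hcon
    have : 2 ^ (m + 1) * 2 ≤ 2 ^ (m + 1) * j := Nat.mul_le_mul_left _ (by omega)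
    omega
  interval_cases j
  · left; rw [show k = 0 by omega, Nat.cast_zero]
  · right; rw [half]; congr 1; omega

/-- The sign character with kernel the rotations works: every element with nontrivial square is a
rotation. For the Klein four-group (`m = 0`) the only nontrivial rotation plays the role of the
central involution. -/
theorem exists_isEffectiveCharacter_of_dihedral {G : Type*} [Group G] [Finite G] (hrk : rk G = 2)
    (P : Sylow 2 G) (hP : IsDihedralTwoGroup P) :
    ∃ χ : P → ℂ, IsEffectiveCharacter 2 P χ ∧ ∀ g h : P, orderOf g = orderOf h → χ g = χ h := by
  obtain ⟨n, hn, ⟨e⟩⟩ := hP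
  obtain ⟨m, rfl⟩ : ∃ m, n = m + 1 := ⟨n - 1, by omega⟩
  have hc2 := half_add_half m
  have hc0 := half_ne_zero m
  have hc := @eq_zero_or_half_of_add_self m
  set c := half m
  let l : DihedralGroup (2 ^ (m + 1)) →* ℂ :=
    { toFun := fun g => match g with
        | .r _ => 1
        | .sr _ => -1
      map_one' := rfl
      map_mul' := by rintro (i | i) (j | j) <;> simp }
  refine exists_isEffectiveCharacter_of_sign hrk P (e.symm (.r c)) (fun g => ?_) (fun h => hc0 ?_)
    ?_ (l.comp e.toMonoidHom) ?_ (fun g hg hg1 hgz => ?_) (fun g h hgh hg => ?_)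
  · apply e.injective
    rw [map_mul, map_mul, e.apply_symm_apply]
    rcases e g with i | i
    · simp [add_comm]
    · simp only [DihedralGroup.sr_mul_r, DihedralGroup.r_mul_sr, DihedralGroup.sr.injEq]
      rw [sub_eq_add_neg, neg_eq_of_add_eq_zero_left hc2]
  · rw [EmbeddingLike.map_eq_one_iff] at h
    rw [DihedralGroup.one_def] at h
    exact DihedralGroup.r.inj h
  · rw [← map_pow, pow_two, DihedralGroup.r_mul_r, hc2, ← DihedralGroup.one_def, map_one]
  · change l (e (e.symm _)) = 1
    rw [e.apply_symm_apply]; rfl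
  · have h1 : e g * e g = 1 := by rw [← map_mul, ← pow_two, hg, map_one]
    change l (e g) = -1
    rcases h : e g with i | i
    · exfalso
      rw [h, DihedralGroup.r_mul_r, DihedralGroup.one_def, DihedralGroup.r.injEq] at h1
      rcases hc h1 with rfl | rfl
      · rw [← DihedralGroup.one_def, EmbeddingLike.map_eq_one_iff] at h
        exact hg1 h
      · exact hgz ((e.eq_symm_apply).mpr h)
    · rfl
  · have key : ∀ g : P, g ^ 2 ≠ 1 → l (e g) = 1 := by
      intro g hg
      rcases h : e g with i | i
      · rfl
      · exfalso
        apply hg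
        apply e.injective
        rw [map_pow, h, map_one, pow_two, DihedralGroup.sr_mul_self]
    have hh : h ^ 2 ≠ 1 := fun h0 => hg (by
      rwa [← orderOf_dvd_iff_pow_eq_one, hgh, orderOf_dvd_iff_pow_eq_one])
    exact (key g hg).trans (key h hh).symm

theorem pow_val_intCast {P : Type*} [Group P] {N : ℕ} [NeZero N] {x : P} (hx : x ^ N = 1)
    (k : ℤ) : x ^ ((k : ZMod N)).val = x ^ k := by
  rw [← zpow_natCast, ZMod.val_intCast]
  conv_rhs => rw [← Int.emod_add_mul_ediv k N]
  rw [zpow_add, zpow_mul, zpow_natCast, hx, one_zpow, mul_one]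

theorem pow_val_add {P : Type*} [Group P] {N : ℕ} [NeZero N] {x : P} (hx : x ^ N = 1)
    (v w : ZMod N) : x ^ (v + w).val = x ^ v.val * x ^ w.val := by
  obtain ⟨a, rfl⟩ := ZMod.intCast_surjective v
  obtain ⟨b, rfl⟩ := ZMod.intCast_surjective w
  rw [← Int.cast_add, pow_val_intCast hx, pow_val_intCast hx, pow_val_intCast hx, zpow_add]

theorem neg_one_pow_val_natCast (m k : ℕ) :
    (-1 : ℂ) ^ ((k : ZMod (2 ^ (m + 1)))).val = (-1) ^ k := by
  rw [ZMod.val_natCast, neg_one_pow_eq_pow_mod_two, neg_one_pow_eq_pow_mod_two (n := k),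
    Nat.mod_mod_of_dvd _ (dvd_pow_self 2 (Nat.succ_ne_zero m))]

/-- The linear character is the one with `l x = l y = -1`. The involutions outside `⟨x⟩` are the `x
^ v * y` with `v` even, where `l` is -1; for `v` odd these elements have order 4 and `l` is 1, as it
is on the elements of order 4 in `⟨x⟩`. -/
theorem exists_isEffectiveCharacter_of_semidihedral {G : Type*} [Group G] [Finite G]
    (hrk : rk G = 2) (P : Sylow 2 G) (hP : IsSemidihedralTwoGroup P) :
    ∃ χ : P → ℂ, IsEffectiveCharacter 2 P χ ∧ ∀ g h : P, orderOf g = orderOf h → χ g = χ h := by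
  obtain ⟨n, hn, hcard, x, y, hgen, hx, hy, hxy⟩ := hP
  obtain ⟨m, rfl⟩ : ∃ m, n = m + 1 := ⟨n - 1, by omega⟩
  rw [Nat.add_sub_cancel] at hxy
  have hm : 2 ≤ m := by omega
  let X : ZMod (2 ^ (m + 1)) → P := fun v => x ^ v.val
  have Xadd : ∀ v w, X (v + w) = X v * X w := pow_val_add hx
  have X0 : X 0 = 1 := by simp [X]
  have X1 : X 1 = x := by
    have := pow_val_intCast hx 1
    simpa [X] using this
  have Xneg : ∀ v, X (-v) = (X v)⁻¹ := fun v => by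
    rw [eq_inv_iff_mul_eq_one, ← Xadd, neg_add_cancel, X0]
  have Xpow : ∀ v (k : ℕ), X v ^ k = X (k * v) := by
    intro v k
    induction k with
    | zero => simp [X0]
    | succ k ih => rw [pow_succ, ih, ← Xadd]; congr 1; push_cast; ring
  have hyy : y * y = 1 := by rw [← pow_two, hy]
  have hcc : half m * half m = 0 := by
    rw [half, ← Nat.cast_mul, ← pow_add, ZMod.natCast_eq_zero_iff]
    exact pow_dvd_pow 2 (by omega)
  have yX : ∀ v, y * X v = X (-v + half m * v) * y := by
    intro v
    obtain ⟨k, rfl⟩ := ZMod.intCast_surjective v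
    have h1 : X ((k : ℤ) : ZMod (2 ^ (m + 1))) = x ^ k := pow_val_intCast hx k
    have h2 : X (-(k : ZMod (2 ^ (m + 1))) + half m * (k : ZMod (2 ^ (m + 1))))
        = x ^ ((-1 + 2 ^ m) * k) := by
      rw [← pow_val_intCast hx]
      simp only [X, half]
      congr 2; push_cast; ring
    rw [h1, h2, zpow_mul, ← hxy, conj_zpow]; group
  have hsurj : Function.Surjective
      (fun q : ZMod (2 ^ (m + 1)) × Bool => if q.2 then X q.1 * y else X q.1) := by
    have hall : ∀ g : P, (∃ v, g = X v) ∨ ∃ v, g = X v * y := by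
      intro g
      have hg : g ∈ Subgroup.closure {x, y} := hgen ▸ Subgroup.mem_top g
      induction hg using Subgroup.closure_induction with
      | mem g hg =>
        rcases hg with rfl | rfl
        · exact Or.inl ⟨1, X1.symm⟩
        · exact Or.inr ⟨0, by rw [X0, one_mul]⟩
      | one => exact Or.inl ⟨0, X0.symm⟩
      | mul g h _ _ ihg ihh =>
        rcases ihg with ⟨v, rfl⟩ | ⟨v, rfl⟩ <;> rcases ihh with ⟨w, rfl⟩ | ⟨w, rfl⟩
        · exact Or.inl ⟨v + w, (Xadd v w).symm⟩
        · exact Or.inr ⟨v + w, by rw [Xadd, mul_assoc]⟩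
        · exact Or.inr ⟨v + (-w + half m * w), by rw [mul_assoc, yX, ← mul_assoc, ← Xadd]⟩
        · exact Or.inl ⟨v + (-w + half m * w), by
            rw [mul_assoc, ← mul_assoc y, yX, mul_assoc (X _) y y, hyy, mul_one, ← Xadd]⟩
      | inv g _ ih =>
        rcases ih with ⟨v, rfl⟩ | ⟨v, rfl⟩
        · exact Or.inl ⟨-v, (Xneg v).symm⟩
        · exact Or.inr ⟨_, by rw [mul_inv_rev, ← Xneg, inv_eq_of_mul_eq_one_left hyy, yX]⟩
    intro g
    rcases hall g with ⟨v, rfl⟩ | ⟨v, rfl⟩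
    · exact ⟨(v, false), rfl⟩
    · exact ⟨(v, true), rfl⟩
  -- The prescribed order of `P` turns the surjective normal form into a bijection.
  have hinj := (Nat.bijective_iff_surjective_and_card _).mpr ⟨hsurj, by
    rw [Nat.card_prod, Nat.card_zmod, Nat.card_eq_fintype_card, Fintype.card_bool, ← pow_succ]
    exact hcard.symm⟩
  let Φ := Equiv.ofBijective _ hinj
  have Φf : ∀ v, Φ.symm (X v) = (v, false) := fun v => by rw [Equiv.symm_apply_eq]; rfl
  have Φt : ∀ v, Φ.symm (X v * y) = (v, true) := fun v => by rw [Equiv.symm_apply_eq]; rfl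
  have hall : ∀ g : P, (∃ v, g = X v) ∨ ∃ v, g = X v * y := by
    intro g
    obtain ⟨⟨v, b⟩, rfl⟩ := hsurj g
    cases b
    · exact Or.inl ⟨v, rfl⟩
    · exact Or.inr ⟨v, rfl⟩
  let sg : ZMod (2 ^ (m + 1)) → ℂ := fun v => (-1) ^ v.val
  have sgn : ∀ k : ℕ, sg k = (-1) ^ k := neg_one_pow_val_natCast m
  have sgadd : ∀ v w, sg (v + w) = sg v * sg w := by
    intro v w
    obtain ⟨a, rfl⟩ := ZMod.natCast_zmod_surjective v
    obtain ⟨b, rfl⟩ := ZMod.natCast_zmod_surjective w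
    rw [← Nat.cast_add, sgn, sgn, sgn, pow_add]
  have sgc : ∀ v, sg (half m * v) = 1 := by
    intro v
    obtain ⟨a, rfl⟩ := ZMod.natCast_zmod_surjective v
    rw [half, ← Nat.cast_mul, sgn]
    exact Even.neg_one_pow ((Nat.even_pow.mpr ⟨even_two, by omega⟩).mul_right a)
  have sgsq : ∀ v, sg v * sg v = 1 := by
    intro v
    rw [← pow_two, ← pow_mul, mul_comm, pow_mul]; norm_num
  have sg0 : sg 0 = 1 := by simp [sg]
  have sgneg : ∀ v, sg (-v) = sg v := by
    intro v
    have h1 : sg (-v) * sg v = sg v * sg v := by rw [← sgadd, neg_add_cancel, sg0, sgsq]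
    exact mul_right_cancel₀ (fun h => by simpa [h] using sgsq v) h1
  have hcv : ∀ v, (sg v = 1 ∧ half m * v = 0) ∨ (sg v = -1 ∧ half m * v = half m) := by
    intro v
    obtain ⟨a, rfl⟩ := ZMod.natCast_zmod_surjective v
    rw [sgn]
    rcases Nat.even_or_odd' a with ⟨b, rfl | rfl⟩
    · left
      refine ⟨by simp, ?_⟩
      have := half_add_half m
      push_cast; linear_combination (b : ZMod (2 ^ (m + 1))) * this
    · right
      refine ⟨by simp [pow_succ], ?_⟩
      have := half_add_half m
      push_cast; linear_combination (b : ZMod (2 ^ (m + 1))) * this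
  let l : P →* ℂ :=
    { toFun := fun g => if (Φ.symm g).2 then -sg (Φ.symm g).1 else sg (Φ.symm g).1
      map_one' := by rw [← X0, Φf]; simpa using sg0
      map_mul' := by
        intro g h
        rcases hall g with ⟨v, rfl⟩ | ⟨v, rfl⟩ <;> rcases hall h with ⟨w, rfl⟩ | ⟨w, rfl⟩
        · rw [← Xadd, Φf, Φf, Φf]; simp [sgadd]
        · rw [← mul_assoc, ← Xadd, Φf, Φt, Φt]; simp [sgadd]
        · rw [mul_assoc, yX, ← mul_assoc, ← Xadd, Φf, Φt, Φt]; simp [sgadd, sgc, sgneg]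
        · rw [mul_assoc, ← mul_assoc y, yX, mul_assoc _ y y, hyy, mul_one, ← Xadd, Φf, Φt, Φt]
          simp [sgadd, sgc, sgneg] }
  have lX : ∀ v, l (X v) = sg v := fun v => by
    change (if (Φ.symm (X v)).2 then _ else _) = _
    rw [Φf]; rfl
  have lXy : ∀ v, l (X v * y) = -sg v := fun v => by
    change (if (Φ.symm (X v * y)).2 then _ else _) = _
    rw [Φt]; rfl
  have Xinj : ∀ v w, X v = X w → v = w := fun v w h => by
    have := congrArg Φ.symm h
    rw [Φf, Φf] at this
    exact congrArg Prod.fst this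
  have sqy : ∀ v, (X v * y) ^ 2 = X (half m * v) := by
    intro v
    rw [pow_two, mul_assoc, ← mul_assoc y, yX, mul_assoc _ y y, hyy, mul_one, ← Xadd]
    congr 1; ring
  have sqX : ∀ v, X v ^ 2 = X (v + v) := fun v => by rw [pow_two, Xadd]
  -- Beyond the involutions, `l` is -1 exactly on the generators of `⟨x⟩`, which are the elements of
  -- maximal order `2 ^ (m + 1)`; this makes `l` a function of the order.
  have hpow : ∀ g, g ^ 2 ≠ 1 → (l g = 1 ∧ g ^ 2 ^ m = 1) ∨ (l g = -1 ∧ g ^ 2 ^ m ≠ 1) := by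
    intro g hg
    rcases hall g with ⟨v, rfl⟩ | ⟨v, rfl⟩
    · have : X v ^ 2 ^ m = X (half m * v) := Xpow v (2 ^ m)
      rw [this, lX]
      rcases hcv v with ⟨h1, h2⟩ | ⟨h1, h2⟩
      · exact Or.inl ⟨h1, by rw [h2, X0]⟩
      · exact Or.inr ⟨h1, by rw [h2, ← X0]; exact fun h => half_ne_zero m (Xinj _ _ h)⟩
    · left
      rw [lXy]
      rcases hcv v with ⟨h1, h2⟩ | ⟨h1, h2⟩
      · rw [sqy, h2, X0] at hg; exact absurd rfl hg
      · refine ⟨by rw [h1, neg_neg], ?_⟩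
        -- The element `x ^ v * y` with `v` odd has order 4, which divides `2 ^ m` because `m ≥ 2`.
        obtain ⟨j, rfl⟩ : ∃ j, m = 2 + j := ⟨m - 2, by omega⟩
        rw [pow_add, pow_mul, show 2 ^ 2 = 2 * 2 by norm_num, pow_mul, sqy, h2, sqX,
          half_add_half, X0, one_pow]
  refine exists_isEffectiveCharacter_of_sign hrk P (X (half m)) (fun g => ?_) (fun h => ?_) ?_ l
    ?_ (fun g hg hg1 hgz => ?_) (fun g h hgh hg => ?_)
  · rcases hall g with ⟨v, rfl⟩ | ⟨v, rfl⟩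
    · rw [← Xadd, ← Xadd, add_comm]
    · rw [mul_assoc, yX, hcc, add_zero, neg_eq_of_add_eq_zero_left (half_add_half m),
        ← mul_assoc, ← mul_assoc, ← Xadd, ← Xadd, add_comm]
  · rw [← X0] at h
    exact half_ne_zero m (Xinj _ _ h)
  · rw [sqX, half_add_half, X0]
  · rw [lX]; simpa using sgc 1
  · rcases hall g with ⟨v, rfl⟩ | ⟨v, rfl⟩
    · rw [sqX, ← X0] at hg
      rcases eq_zero_or_half_of_add_self (Xinj _ _ hg) with rfl | rfl
      · exact absurd X0 hg1
      · exact absurd rfl hgz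
    · rw [sqy, ← X0] at hg
      rw [lXy]
      rcases hcv v with ⟨h1, -⟩ | ⟨-, h2⟩
      · rw [h1]
      · exact absurd (h2.symm.trans (Xinj _ _ hg)) (half_ne_zero m)
  · have hh : h ^ 2 ≠ 1 := fun h0 => hg (by
      rwa [← orderOf_dvd_iff_pow_eq_one, hgh, orderOf_dvd_iff_pow_eq_one])
    have hiff : g ^ 2 ^ m = 1 ↔ h ^ 2 ^ m = 1 := by
      rw [← orderOf_dvd_iff_pow_eq_one, hgh, orderOf_dvd_iff_pow_eq_one]
    rcases hpow g hg with ⟨h1, h2⟩ | ⟨h1, h2⟩ <;> rcases hpow h hh with ⟨h3, h4⟩ | ⟨h3, h4⟩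
    · rw [h1, h3]
    · exact absurd (hiff.mp h2) h4
    · exact absurd (hiff.mpr h4) h2
    · rw [h1, h3]

/-! ### Coordinates on wreathed groups -/

/-- `S = {κ v} ∪ {κ v * z}` is the wreath product of the cyclic group of order `2 ^ (m + 1)` by the
group of order two, with base group the image of `κ` and swapping involution `z`. -/
structure WreathCoords {G : Type*} [Group G] (m : ℕ) (S : Subgroup G)
    (κ : ZMod (2 ^ (m + 1)) × ZMod (2 ^ (m + 1)) → G) (z : G) : Prop where
  map_add : ∀ v w, κ (v + w) = κ v * κ w
  inj : Function.Injective κ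
  swap : ∀ v, z * κ v = κ v.swap * z
  sq : z * z = 1
  mem_iff : ∀ g, g ∈ S ↔ ∃ v, g = κ v ∨ g = κ v * z
  not_base : ∀ v, z ≠ κ v

namespace WreathCoords

variable {G : Type*} [Group G] {m : ℕ} {S : Subgroup G}
  {κ : ZMod (2 ^ (m + 1)) × ZMod (2 ^ (m + 1)) → G} {z : G}

theorem map_zero (c : WreathCoords m S κ z) : κ 0 = 1 := by
  have := c.map_add 0 0
  rwa [add_zero, left_eq_mul] at this

theorem map_neg (c : WreathCoords m S κ z) (v) : κ (-v) = (κ v)⁻¹ := by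
  rw [eq_inv_iff_mul_eq_one, ← c.map_add, neg_add_cancel, c.map_zero]

theorem comm (c : WreathCoords m S κ z) (v w) : κ v * κ w = κ w * κ v := by
  rw [← c.map_add, ← c.map_add, add_comm]

theorem map_sq (c : WreathCoords m S κ z) (v) : κ v ^ 2 = κ (v + v) := by
  rw [c.map_add, pow_two]

theorem inv_z (c : WreathCoords m S κ z) : z⁻¹ = z := inv_eq_of_mul_eq_one_left c.sq

theorem mul_z_ne (c : WreathCoords m S κ z) (v w) : κ v * z ≠ κ w := by
  intro h
  apply c.not_base (-v + w)
  rw [c.map_add, c.map_neg, ← h, inv_mul_cancel_left]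

theorem mul_z_mul (c : WreathCoords m S κ z) (v w) : κ v * z * κ w = κ (v + w.swap) * z := by
  rw [mul_assoc, c.swap, ← mul_assoc, c.map_add]

theorem mul_z_mul_z (c : WreathCoords m S κ z) (v w) :
    κ v * z * (κ w * z) = κ (v + w.swap) := by
  rw [← mul_assoc, c.mul_z_mul, mul_assoc, c.sq, mul_one]

theorem sq_mul_z (c : WreathCoords m S κ z) (v) : (κ v * z) ^ 2 = κ (v + v.swap) := by
  rw [pow_two, c.mul_z_mul_z]

theorem inv_mul_z (c : WreathCoords m S κ z) (v) : (κ v * z)⁻¹ = κ (-v.swap) * z := by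
  rw [mul_inv_rev, c.inv_z, ← c.map_neg, c.swap]; rfl

theorem conj_mul_z (c : WreathCoords m S κ z) (v w) :
    (κ v * z) * κ w * (κ v * z)⁻¹ = κ w.swap := by
  rw [c.inv_mul_z, c.mul_z_mul, c.mul_z_mul_z]; congr 1; ext <;> simp

theorem conj_base (c : WreathCoords m S κ z) (v w) : κ v * κ w * (κ v)⁻¹ = κ w := by
  rw [c.comm, mul_inv_cancel_right]

theorem base_mem (c : WreathCoords m S κ z) (v) : κ v ∈ S := (c.mem_iff _).mpr ⟨v, Or.inl rfl⟩

theorem mul_z_mem (c : WreathCoords m S κ z) (v) : κ v * z ∈ S :=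
  (c.mem_iff _).mpr ⟨v, Or.inr rfl⟩

theorem z_mem (c : WreathCoords m S κ z) : z ∈ S := by
  simpa [c.map_zero] using c.mul_z_mem 0

theorem exists_fun (c : WreathCoords m S κ z) {α : Type*} [Inhabited α]
    (φ ψ : ZMod (2 ^ (m + 1)) × ZMod (2 ^ (m + 1)) → α) :
    ∃ f : G → α, (∀ v, f (κ v) = φ v) ∧ ∀ v, f (κ v * z) = ψ v := by
  classical
  refine ⟨fun g => if h : ∃ v, g = κ v then φ h.choose else
    if h : ∃ v, g = κ v * z then ψ h.choose else default, fun v => ?_, fun v => ?_⟩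
  · have h : ∃ w, κ v = κ w := ⟨v, rfl⟩
    exact (dif_pos h).trans (by rw [← c.inj h.choose_spec])
  · have h : ∃ w, κ v * z = κ w * z := ⟨v, rfl⟩
    exact (dif_neg fun h' => c.mul_z_ne _ _ h'.choose_spec).trans
      ((dif_pos h).trans (by rw [← c.inj (mul_right_cancel h.choose_spec)]))

theorem map (c : WreathCoords m S κ z) {H : Type*} [Group H] (f : G →* H)
    (hf : Function.Injective f) : WreathCoords m (S.map f) (fun v => f (κ v)) (f z) where
  map_add v w := by rw [c.map_add, _root_.map_mul]
  inj := hf.comp c.inj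
  swap v := by rw [← _root_.map_mul, c.swap, _root_.map_mul]
  sq := by rw [← _root_.map_mul, c.sq, _root_.map_one]
  mem_iff g := by
    rw [Subgroup.mem_map]
    constructor
    · rintro ⟨x, hx, rfl⟩
      obtain ⟨v, rfl | rfl⟩ := (c.mem_iff x).mp hx
      · exact ⟨v, Or.inl rfl⟩
      · exact ⟨v, Or.inr (_root_.map_mul f _ _)⟩
    · rintro ⟨v, rfl | rfl⟩
      · exact ⟨_, c.base_mem v, rfl⟩
      · exact ⟨_, c.mul_z_mem v, _root_.map_mul f _ _⟩
  not_base v h := c.not_base v (hf h)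

end WreathCoords

theorem exists_wreathCoords {P : Type*} [Group P] (hP : IsWreathedTwoGroup P) :
    ∃ m, 1 ≤ m ∧ ∃ κ z, WreathCoords m (⊤ : Subgroup P) κ z := by
  obtain ⟨n, hn, hcard, x, y, z, hgen, hx, hy, hz, hxy, hzx⟩ := hP
  obtain ⟨m, rfl⟩ : ∃ m, n = m + 1 := ⟨n - 1, by omega⟩
  have hzz : z * z = 1 := by rw [← pow_two, hz]
  have hzi : z⁻¹ = z := inv_eq_of_mul_eq_one_left hzz
  have hzy : z * y * z⁻¹ = x := by
    rw [← hzx, hzi]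
    simp only [mul_assoc, hzz, mul_one]
    rw [← mul_assoc, hzz, one_mul]
  let κ : ZMod (2 ^ (m + 1)) × ZMod (2 ^ (m + 1)) → P := fun v => x ^ v.1.val * y ^ v.2.val
  have hcomm : ∀ i j : ℕ, y ^ i * x ^ j = x ^ j * y ^ i := fun i j =>
    (Commute.pow_pow (show Commute y x from hxy.symm) i j)
  have hadd : ∀ v w, κ (v + w) = κ v * κ w := by
    intro v w
    simp only [κ, Prod.fst_add, Prod.snd_add, pow_val_add hx, pow_val_add hy]
    rw [mul_assoc, mul_assoc, ← mul_assoc (y ^ _) (x ^ _), hcomm]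
    simp only [mul_assoc]
  have hswap : ∀ v, z * κ v = κ v.swap * z := by
    intro v
    have h1 : z * κ v * z⁻¹ = κ v.swap := by
      have : z * κ v * z⁻¹ = (z * x * z⁻¹) ^ v.1.val * (z * y * z⁻¹) ^ v.2.val := by
        rw [conj_pow, conj_pow]; simp only [κ]; group
      rw [this, hzx, hzy, hcomm]; rfl
    rw [← h1, inv_mul_cancel_right]
  have h0 : κ 0 = 1 := by simp [κ]
  have hx1 : κ (1, 0) = x := by
    have := pow_val_intCast hx 1
    simpa [κ] using this
  have hy1 : κ (0, 1) = y := by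
    have := pow_val_intCast hy 1
    simpa [κ] using this
  have hneg : ∀ v, κ (-v) = (κ v)⁻¹ := fun v => by
    rw [eq_inv_iff_mul_eq_one, ← hadd, neg_add_cancel, h0]
  have hall : ∀ g : P, ∃ v, g = κ v ∨ g = κ v * z := by
    intro g
    have hg : g ∈ Subgroup.closure {x, y, z} := hgen ▸ Subgroup.mem_top g
    induction hg using Subgroup.closure_induction with
    | mem g hg =>
      rcases hg with rfl | rfl | rfl
      · exact ⟨_, Or.inl hx1.symm⟩
      · exact ⟨_, Or.inl hy1.symm⟩
      · exact ⟨0, Or.inr (by rw [h0, one_mul])⟩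
    | one => exact ⟨0, Or.inl h0.symm⟩
    | mul g h _ _ ihg ihh =>
      obtain ⟨v, rfl | rfl⟩ := ihg <;> obtain ⟨w, rfl | rfl⟩ := ihh
      · exact ⟨v + w, Or.inl (hadd v w).symm⟩
      · exact ⟨v + w, Or.inr (by rw [hadd]; exact (mul_assoc _ _ _).symm)⟩
      · exact ⟨v + w.swap, Or.inr (by rw [mul_assoc, hswap, hadd]; exact (mul_assoc _ _ _).symm)⟩
      · exact ⟨v + w.swap, Or.inl (by
          rw [mul_assoc, ← mul_assoc z, hswap, mul_assoc (κ _) z z, hzz, mul_one, hadd])⟩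
    | inv g _ ih =>
      obtain ⟨v, rfl | rfl⟩ := ih
      · exact ⟨-v, Or.inl (hneg v).symm⟩
      · exact ⟨(-v).swap, Or.inr (by rw [mul_inv_rev, hzi, ← hneg, hswap])⟩
  -- As there are as many normal forms as elements of `P`, surjectivity yields both the injectivity
  -- of `κ` and the disjointness of the two cosets.
  have hsurj : Function.Surjective
      (fun q : (ZMod (2 ^ (m + 1)) × ZMod (2 ^ (m + 1))) × Bool =>
        if q.2 then κ q.1 * z else κ q.1) := by
    intro g
    obtain ⟨v, rfl | rfl⟩ := hall g
    · exact ⟨(v, false), rfl⟩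
    · exact ⟨(v, true), rfl⟩
  have hinj := ((Nat.bijective_iff_surjective_and_card _).mpr ⟨hsurj, by
    rw [Nat.card_prod, Nat.card_prod, Nat.card_zmod, hcard, Nat.card_eq_fintype_card (α := Bool),
      Fintype.card_bool, ← pow_add, ← pow_succ]; congr 1; ring⟩).1
  refine ⟨m, by omega, κ, z, hadd, fun v w h => ?_, hswap, hzz, fun g => ?_, fun v h => ?_⟩
  · exact congrArg Prod.fst (@hinj (v, false) (w, false) h)
  · simpa using hall g
  · have := @hinj (0, true) (v, false) (by simpa [h0] using h)
    simpa using congrArg Prod.snd this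

/-! ### The character of a wreathed group -/

/-- The normalized sum of the faithful complex characters of the cyclic group of order
`2 ^ (m + 1)`. -/
noncomputable def ramanujan (m : ℕ) (v : ZMod (2 ^ (m + 1))) : ℂ :=
  if v = 0 then 1 else if v = half m then -1 else 0

theorem ramanujan_zero (m : ℕ) : ramanujan m 0 = 1 := if_pos rfl

theorem ramanujan_half (m : ℕ) : ramanujan m (half m) = -1 := by
  rw [ramanujan, if_neg (half_ne_zero m), if_pos rfl]

theorem ramanujan_eq_zero {m : ℕ} {v : ZMod (2 ^ (m + 1))} (hv : v + v ≠ 0) :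
    ramanujan m v = 0 := by
  rw [ramanujan, if_neg, if_neg]
  · rintro rfl; exact hv (half_add_half m)
  · rintro rfl; exact hv (add_zero 0)

/-- `ramanujan m` is the sign character of the subgroup `{0, half m}` extended by zero, hence
admissible for `isCharacter_sum_conj`. -/
theorem ramanujan_add {m : ℕ} {v : ZMod (2 ^ (m + 1))} (hv : ramanujan m v ≠ 0)
    (w : ZMod (2 ^ (m + 1))) : ramanujan m (v + w) = ramanujan m v * ramanujan m w := by
  have hv2 : v + v = 0 := not_not.mp fun h => hv (ramanujan_eq_zero h)
  by_cases hw : w + w = 0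
  · rcases eq_zero_or_half_of_add_self hv2 with rfl | rfl <;>
    rcases eq_zero_or_half_of_add_self hw with rfl | rfl <;>
    simp [ramanujan_zero, ramanujan_half, half_add_half]
  · rw [ramanujan_eq_zero hw, mul_zero, ramanujan_eq_zero]
    rwa [add_add_add_comm, hv2, zero_add]

/-- Two induced characters are added. The function `f` is supported in the base group, and its
conjugates give the terms in `l`; `f'` is constant on conjugacy classes and changes sign on the
outer coset. -/
theorem WreathCoords.isCharacter {P : Type*} [Group P] [Fintype P] {m : ℕ}
    {κ : ZMod (2 ^ (m + 1)) × ZMod (2 ^ (m + 1)) → P} {z : P}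
    (c : WreathCoords m (⊤ : Subgroup P) κ z)
    (l : ZMod (2 ^ (m + 1)) × ZMod (2 ^ (m + 1)) →+ ZMod (2 ^ (m + 1))) {χ : P → ℂ}
    (h1 : ∀ v, χ (κ v) = Fintype.card P *
      (ramanujan m (v.1 + v.2) + ramanujan m (l v) + ramanujan m (l v.swap)))
    (h2 : ∀ v, χ (κ v * z) = -(Fintype.card P * ramanujan m (v.1 + v.2))) :
    IsCharacter χ := by
  have hall : ∀ g, ∃ v, g = κ v ∨ g = κ v * z := fun g => (c.mem_iff g).mp (Subgroup.mem_top g)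
  obtain ⟨f, hf1, hf2⟩ := c.exists_fun (fun v => ramanujan m (l v)) (fun _ => 0)
  obtain ⟨f', hf1', hf2'⟩ := c.exists_fun (fun v => ramanujan m (v.1 + v.2))
    (fun v => -ramanujan m (v.1 + v.2))
  have hf : IsCharacter (fun g => ∑ t, f (t⁻¹ * g * t)) := by
    refine isCharacter_sum_conj (by rw [← c.map_zero, hf1, _root_.map_zero, ramanujan_zero]) ?_
    intro g h hg
    obtain ⟨v, rfl | rfl⟩ := hall g <;> obtain ⟨w, rfl | rfl⟩ := hall h
    · rw [hf1] at hg
      rw [← c.map_add, hf1, hf1, hf1, _root_.map_add, ramanujan_add hg]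
    · rw [← mul_assoc, ← c.map_add, hf2, hf2, mul_zero]
    · exact absurd (hf2 v) hg
    · exact absurd (hf2 v) hg
  have hf' : IsCharacter (fun g => ∑ t, f' (t⁻¹ * g * t)) := by
    refine isCharacter_sum_conj (by simp [← c.map_zero, hf1', ramanujan_zero]) ?_
    intro g h hg
    obtain ⟨v, rfl | rfl⟩ := hall g <;> obtain ⟨w, rfl | rfl⟩ := hall h
    · rw [hf1'] at hg
      rw [← c.map_add, hf1', hf1', hf1', ← ramanujan_add hg]
      congr 1; simp only [Prod.fst_add, Prod.snd_add]; ring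
    · rw [hf1'] at hg
      rw [← mul_assoc, ← c.map_add, hf2', hf1', hf2', mul_neg, ← ramanujan_add hg]
      congr 2; simp only [Prod.fst_add, Prod.snd_add]; ring
    · rw [hf2', neg_ne_zero] at hg
      rw [c.mul_z_mul, hf2', hf1', hf2', neg_mul, ← ramanujan_add hg]
      congr 2; simp only [Prod.fst_add, Prod.snd_add, Prod.fst_swap, Prod.snd_swap]; ring
    · rw [hf2', neg_ne_zero] at hg
      rw [c.mul_z_mul_z, hf1', hf2', hf2', neg_mul_neg, ← ramanujan_add hg]
      congr 1; simp only [Prod.fst_add, Prod.snd_add, Prod.fst_swap, Prod.snd_swap]; ring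
  -- Pairing `t` with `t * z` makes each summand symmetric under the swap, which accounts for the
  -- factor 2 in front of the character of `f`.
  have hsum : ∀ g, 2 * ∑ t, f (t⁻¹ * g * t) = ∑ t, (f (t⁻¹ * g * t) +
      f ((t * z)⁻¹ * g * (t * z))) := by
    intro g
    rw [Finset.sum_add_distrib, two_mul]
    congr 1
    exact (Equiv.sum_comp (Equiv.mulRight z) (fun t => f (t⁻¹ * g * t))).symm
  have hconjA : ∀ v w, (κ v)⁻¹ * κ w * κ v = κ w := fun v w => by
    rw [mul_assoc, c.comm, inv_mul_cancel_left]
  have hconjB : ∀ v w, (κ v * z)⁻¹ * κ w * (κ v * z) = κ w.swap := fun v w => by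
    have := c.conj_mul_z (-v.swap) w
    rwa [← c.inv_mul_z, inv_inv] at this
  convert isCharacter_add (isCharacter_nsmul hf zero_lt_two) hf' using 2 with g
  rw [Nat.cast_two, hsum]
  obtain ⟨w, rfl | rfl⟩ := hall g
  · have e1 : ∀ t, f (t⁻¹ * κ w * t) + f ((t * z)⁻¹ * κ w * (t * z))
        = ramanujan m (l w) + ramanujan m (l w.swap) := by
      intro t
      obtain ⟨v, rfl | rfl⟩ := hall t
      · rw [hconjA, hconjB, hf1, hf1]
      · rw [mul_assoc (κ v) z z, c.sq, mul_one, hconjA, hconjB, hf1, hf1, add_comm]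
    have e2 : ∀ t, f' (t⁻¹ * κ w * t) = ramanujan m (w.1 + w.2) := by
      intro t
      obtain ⟨v, rfl | rfl⟩ := hall t
      · rw [hconjA, hf1']
      · rw [hconjB, hf1', Prod.fst_swap, Prod.snd_swap, add_comm]
    simp only [e1, e2, Finset.sum_const, Finset.card_univ, nsmul_eq_mul, h1]
    ring
  · have hB : ∀ t, ∃ v, t⁻¹ * (κ w * z) * t = κ v * z ∧ v.1 + v.2 = w.1 + w.2 := by
      intro t
      obtain ⟨v, rfl | rfl⟩ := hall t
      · refine ⟨-v + w + v.swap, ?_, by simp; ring⟩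
        rw [← c.map_neg, ← mul_assoc, ← c.map_add, c.mul_z_mul]
      · refine ⟨-v.swap + w.swap + v, ?_, by simp; ring⟩
        rw [c.inv_mul_z, c.mul_z_mul_z, ← mul_assoc, ← c.map_add]
    have e1 : ∀ t, f (t⁻¹ * (κ w * z) * t) = 0 := by
      intro t
      obtain ⟨v, hv, -⟩ := hB t
      rw [hv, hf2]
    have e2 : ∀ t, f' (t⁻¹ * (κ w * z) * t) = -ramanujan m (w.1 + w.2) := by
      intro t
      obtain ⟨v, hv, hv'⟩ := hB t
      rw [hv, hf2', hv']
    simp only [e1, e2, Finset.sum_const, Finset.card_univ, nsmul_eq_mul, h2]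
    ring

/-! ### Fusion inside the base group -/

/-- Sylow's theorem inside `M`: the conjugating element lies in `M`, so it respects whatever
condition defines `M`. -/
theorem exists_conj_into_sylow {G : Type*} [Group G] [Finite G] {p : ℕ} [Fact p.Prime]
    {M D E : Subgroup G} (hD : IsPGroup p D) (hE : IsPGroup p E) (hDM : D ≤ M) (hEM : E ≤ M) :
    ∃ w ∈ M, ∃ Q : Sylow p G, D ≤ Q ∧ ∀ e ∈ E, w * e * w⁻¹ ∈ Q := by
  obtain ⟨S, hS⟩ := (hD.comap_of_injective M.subtype M.subtype_injective).exists_le_sylow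
  obtain ⟨T, hT⟩ := (hE.comap_of_injective M.subtype M.subtype_injective).exists_le_sylow
  obtain ⟨w, rfl⟩ := MulAction.exists_smul_eq M T S
  obtain ⟨Q, hQ⟩ := ((w • T).isPGroup'.map M.subtype).exists_le_sylow
  refine ⟨w, w.2, Q, fun d hd => ?_, fun e he => ?_⟩
  · exact hQ ⟨⟨d, hDM hd⟩, hS hd, rfl⟩
  · refine hQ ⟨w * ⟨e, hEM he⟩ * w⁻¹, ?_, rfl⟩
    have h1 : (⟨e, hEM he⟩ : M) ∈ T := hT he
    exact Subgroup.smul_mem_pointwise_smul _ (MulAut.conj w) _ h1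

/-- Conjugation by `n` acts on the base group through the automorphism `θ`. -/
def ActsBy {G V : Type*} [Group G] [Add V] (κ : V → G) (n : G) (θ : V ≃+ V) : Prop :=
  ∀ v, n * κ v * n⁻¹ = κ (θ v)

theorem ActsBy.mul {G V : Type*} [Group G] [Add V] {κ : V → G} {n n' : G} {θ θ' : V ≃+ V}
    (h : ActsBy κ n θ) (h' : ActsBy κ n' θ') : ActsBy κ (n * n') (θ'.trans θ) := by
  intro v
  rw [AddEquiv.trans_apply, ← h, ← h']; group

theorem ActsBy.inv {G V : Type*} [Group G] [Add V] {κ : V → G} {n : G} {θ : V ≃+ V}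
    (h : ActsBy κ n θ) : ActsBy κ n⁻¹ θ.symm := by
  intro v
  have := h (θ.symm v)
  rw [AddEquiv.apply_symm_apply] at this
  rw [← this]; group

theorem ActsBy.pow {G V : Type*} [Group G] [Add V] {κ : V → G} {n : G} {θ : V ≃+ V}
    (h : ActsBy κ n θ) (k : ℕ) (v : V) : n ^ k * κ v * (n ^ k)⁻¹ = κ (θ^[k] v) := by
  induction k with
  | zero => simp
  | succ k ih =>
    rw [Function.iterate_succ_apply', ← h, ← ih, pow_succ']; group

namespace WreathCoords

variable {G : Type*} [Group G] {m : ℕ} {S : Subgroup G}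
  {κ : ZMod (2 ^ (m + 1)) × ZMod (2 ^ (m + 1)) → G} {z : G}

/-- The base group of a wreath product. -/
def base (c : WreathCoords m S κ z) : Subgroup G where
  carrier := Set.range κ
  mul_mem' := by
    rintro _ _ ⟨v, rfl⟩ ⟨w, rfl⟩
    exact ⟨v + w, c.map_add v w⟩
  one_mem' := ⟨0, c.map_zero⟩
  inv_mem' := by
    rintro _ ⟨v, rfl⟩
    exact ⟨-v, c.map_neg v⟩

theorem base_le (c : WreathCoords m S κ z) : c.base ≤ S := by
  rintro _ ⟨v, rfl⟩; exact c.base_mem v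

theorem card_base (c : WreathCoords m S κ z) :
    Nat.card c.base = 2 ^ (m + 1) * 2 ^ (m + 1) := by
  change Nat.card (Set.range κ) = _
  rw [Nat.card_range_of_injective c.inj, Nat.card_prod, Nat.card_zmod]

theorem exists_actsBy (c : WreathCoords m S κ z) {n : G} (h : ∀ v, ∃ w, n * κ v * n⁻¹ = κ w) :
    ∃ θ, ActsBy κ n θ := by
  choose f hf using h
  have hinj : Function.Injective f := by
    intro v w hvw
    apply c.inj
    have h1 := hf v
    rw [hvw, ← hf w] at h1
    exact mul_left_cancel (mul_right_cancel h1)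
  refine ⟨{ Equiv.ofBijective f (Finite.injective_iff_bijective.mp hinj) with
    map_add' := fun v w => c.inj ?_ }, fun v => hf v⟩
  change κ (f (v + w)) = κ (f v + f w)
  rw [c.map_add, ← hf, ← hf, ← hf, c.map_add]; group

theorem actsBy_swap (c : WreathCoords m S κ z) : ActsBy κ z AddEquiv.prodComm := by
  intro v
  rw [c.swap, mul_inv_cancel_right]; rfl

theorem eq_diag_of_commute (c : WreathCoords m S κ z) {v w}
    (h : κ v * z * κ w = κ w * (κ v * z)) : w.1 = w.2 := by
  rw [c.mul_z_mul, ← mul_assoc, ← c.map_add] at h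
  have := congrArg Prod.fst (c.inj (mul_right_cancel h))
  simp only [Prod.fst_add, Prod.fst_swap] at this
  exact (add_left_cancel (this.trans (add_comm w.1 v.1))).symm

theorem commute_of_diag (c : WreathCoords m S κ z) {w} (hw : w.1 = w.2) {g : G} (hg : g ∈ S) :
    g * κ w = κ w * g := by
  have hs : w.swap = w := Prod.ext hw.symm hw
  obtain ⟨v, rfl | rfl⟩ := (c.mem_iff g).mp hg
  · exact c.comm v w
  · rw [c.mul_z_mul, ← mul_assoc, ← c.map_add, hs, add_comm]

/-- An outer element commutes only with the diagonal of the base group. An abelian `B` containing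
one therefore has order at most `2 * 2 ^ (m + 1)`, which is too small once `m ≥ 1`. -/
theorem le_base_of_comm (c : WreathCoords m S κ z) (hm : 1 ≤ m) {B : Subgroup G} (hBS : B ≤ S)
    (hB : ∀ a ∈ B, ∀ b ∈ B, a * b = b * a) (hcard : Nat.card B = 2 ^ (m + 1) * 2 ^ (m + 1)) :
    B ≤ c.base := by
  by_contra hle
  obtain ⟨b, hb, hbn⟩ := Set.not_subset.mp hle
  obtain ⟨v, rfl | rfl⟩ := (c.mem_iff b).mp (hBS hb)
  · exact hbn ⟨v, rfl⟩
  have hdiag : ∀ w, κ w ∈ B → w = (w.1, w.1) := fun w hw =>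
    Prod.ext rfl (c.eq_diag_of_commute (hB _ hb _ hw)).symm
  have hsub : (B : Set G) ⊆ Set.range (fun q : ZMod (2 ^ (m + 1)) × Bool =>
      if q.2 then κ (q.1, q.1) * (κ v * z) else κ (q.1, q.1)) := by
    intro x hx
    obtain ⟨w, rfl | rfl⟩ := (c.mem_iff x).mp (hBS hx)
    · exact ⟨(w.1, false), by rw [hdiag w hx]; rfl⟩
    · have h1 : κ w * z * (κ v * z)⁻¹ = κ (w - v) := by
        rw [mul_inv_rev, mul_assoc, mul_inv_cancel_left, ← c.map_neg, ← c.map_add, sub_eq_add_neg]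
      have h2 : κ (w - v) ∈ B := h1 ▸ B.mul_mem hx (B.inv_mem hb)
      refine ⟨((w - v).1, true), ?_⟩
      change κ ((w - v).1, (w - v).1) * (κ v * z) = _
      rw [← hdiag _ h2, ← h1, inv_mul_cancel_right]
  have h1 : Nat.card B ≤ Nat.card (ZMod (2 ^ (m + 1)) × Bool) :=
    (Nat.card_mono (Set.finite_range _) hsub).trans (Finite.card_range_le _)
  rw [hcard, Nat.card_prod, Nat.card_zmod, Nat.card_eq_fintype_card, Fintype.card_bool] at h1
  have h2 : 2 ^ (m + 1) ≤ 2 := Nat.le_of_mul_le_mul_left h1 (by positivity)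
  have h3 : 2 ^ 2 ≤ 2 ^ (m + 1) := Nat.pow_le_pow_right (by norm_num) (by omega)
  omega

theorem conj_sylow [Finite G] {P : Sylow 2 G} (c : WreathCoords m (P : Subgroup G) κ z)
    (Q : Sylow 2 G) :
    ∃ r, WreathCoords m (Q : Subgroup G) (fun v => r * κ v * r⁻¹) (r * z * r⁻¹) := by
  obtain ⟨r, rfl⟩ := MulAction.exists_smul_eq G P Q
  exact ⟨r, c.map (MulAut.conj r).toMonoidHom (MulAut.conj r).injective⟩

/-- By `le_base_of_comm` in `Q`, conjugation by `g` carries the base group of `P` onto that of `Q`,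
and conjugation by `r⁻¹` brings it back. -/
theorem exists_actsBy_of_sylow [Finite G] {P : Sylow 2 G} (c : WreathCoords m (P : Subgroup G) κ z)
    (hm : 1 ≤ m) {Q : Sylow 2 G} {r : G}
    (d : WreathCoords m (Q : Subgroup G) (fun v => r * κ v * r⁻¹) (r * z * r⁻¹))
    {g : G} (hg : ∀ v, g * κ v * g⁻¹ ∈ Q) : ∃ θ, ActsBy κ (r⁻¹ * g) θ := by
  have hle : c.base.map (MulAut.conj g).toMonoidHom ≤ d.base := by
    apply d.le_base_of_comm hm
    · rintro _ ⟨_, ⟨v, rfl⟩, rfl⟩; exact hg v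
    · rintro _ ⟨_, ⟨v, rfl⟩, rfl⟩ _ ⟨_, ⟨w, rfl⟩, rfl⟩
      rw [← _root_.map_mul, c.comm, _root_.map_mul]
    · rw [← c.card_base]
      exact Nat.card_congr
        (c.base.equivMapOfInjective _ (MulAut.conj g).injective).symm.toEquiv
  refine c.exists_actsBy fun v => ?_
  obtain ⟨w, hw⟩ := hle ⟨_, ⟨v, rfl⟩, rfl⟩
  refine ⟨w, ?_⟩
  have hw' : r * κ w * r⁻¹ = g * κ v * g⁻¹ := hw
  have : κ w = r⁻¹ * (r * κ w * r⁻¹) * r := by group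
  rw [this, hw']; group

/-- Burnside's fusion argument: the base group and its conjugate by `g` both centralize `κ w`. An
element of this centralizer moves them into a common Sylow subgroup, where they coincide. -/
theorem exists_actsBy_of_fusion [Finite G] {P : Sylow 2 G}
    (c : WreathCoords m (P : Subgroup G) κ z) (hm : 1 ≤ m) {g : G} {v w}
    (hg : g * κ v * g⁻¹ = κ w) : ∃ n θ, ActsBy κ n θ ∧ θ v = w := by
  have hP : IsPGroup 2 c.base := P.isPGroup'.to_le c.base_le
  obtain ⟨x, hx, Q, hQ1, hQ2⟩ := exists_conj_into_sylow (M := Subgroup.centralizer {κ w}) hP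
    (hP.map (MulAut.conj g).toMonoidHom) (by
      rintro _ ⟨u, rfl⟩
      rw [Subgroup.mem_centralizer_singleton_iff]; exact c.comm _ _) (by
      rintro _ ⟨_, ⟨u, rfl⟩, rfl⟩
      rw [Subgroup.mem_centralizer_singleton_iff, ← hg]
      change (MulAut.conj g) (κ u) * (MulAut.conj g) (κ v)
        = (MulAut.conj g) (κ v) * (MulAut.conj g) (κ u)
      rw [← _root_.map_mul, c.comm, _root_.map_mul])
  obtain ⟨r, d⟩ := c.conj_sylow Q
  obtain ⟨θ, h1⟩ := c.exists_actsBy_of_sylow hm d (g := 1) fun u => by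
    rw [one_mul, inv_one, mul_one]; exact hQ1 ⟨u, rfl⟩
  obtain ⟨θ', h2⟩ := c.exists_actsBy_of_sylow hm d (g := x * g) fun u => by
    have := hQ2 _ ⟨_, ⟨u, rfl⟩, rfl⟩
    simpa [mul_assoc] using this
  refine ⟨_, _, h1.inv.mul h2, c.inj ?_⟩
  rw [← (h1.inv.mul h2) v]
  rw [Subgroup.mem_centralizer_singleton_iff] at hx
  have e : (r⁻¹ * 1)⁻¹ * (r⁻¹ * (x * g)) = x * g := by group
  rw [e, mul_inv_rev, show x * g * κ v * (g⁻¹ * x⁻¹) = x * (g * κ v * g⁻¹) * x⁻¹ by group, hg, hx,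
    mul_inv_cancel_right]

theorem eq_of_add_self {v : ZMod (2 ^ (m + 1)) × ZMod (2 ^ (m + 1))} (hv : v + v = 0) :
    v = 0 ∨ v = (half m, 0) ∨ v = (0, half m) ∨ v = (half m, half m) := by
  obtain ⟨s, t⟩ := v
  have h1 : s + s = 0 := congrArg Prod.fst hv
  have h2 : t + t = 0 := congrArg Prod.snd hv
  rcases eq_zero_or_half_of_add_self h1 with rfl | rfl <;>
  rcases eq_zero_or_half_of_add_self h2 with rfl | rfl <;> simp

/-- If `θ^[2 ^ i]` fixes `v + v`, it sends `v` to `v + e` with `e + e = 0`. As `θ` fixes `e`,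
applying it twice gives `v + e + e = v`. -/
theorem iterate_fix {V : Type*} [AddCommGroup V] (θ : V ≃+ V) (h : ∀ v, v + v = 0 → θ v = v)
    (i : ℕ) : ∀ v, (2 ^ (i + 1)) • v = 0 → θ^[2 ^ i] v = v := by
  induction i with
  | zero => intro v hv; exact h v (by simpa [two_nsmul] using hv)
  | succ i ih =>
    intro v hv
    have hadd : ∀ k : ℕ, ∀ v w, θ^[k] (v + w) = θ^[k] v + θ^[k] w := by
      intro k
      induction k with
      | zero => intro v w; rfl
      | succ k ihk => intro v w; simp only [Function.iterate_succ_apply, _root_.map_add, ihk]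
    have h1 := ih (v + v) (by rw [← two_nsmul, ← mul_nsmul', ← pow_succ]; exact hv)
    rw [hadd] at h1
    obtain ⟨e, he⟩ : ∃ e, θ^[2 ^ i] v = v + e := ⟨θ^[2 ^ i] v - v, by abel⟩
    have he2 : e + e = 0 := by
      rw [he] at h1
      have : v + v + (e + e) = v + v := by rw [← add_add_add_comm, h1]
      exact left_eq_add.mp this.symm
    have he3 : θ^[2 ^ i] e = e := Function.iterate_fixed (h e he2) _
    rw [pow_succ, mul_two, Function.iterate_add_apply, he, hadd, he, he3, add_assoc, he2, add_zero]

/-- Two coprime powers of `n` centralize the base group: `n ^ 2 ^ m` by `iterate_fix`, and `n ^ q`,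
with `q` the odd part of the order of `n`, because a 2-element normalizing the base group acts on it
trivially or as a swap in a suitable Sylow subgroup, and a swap moves involutions. -/
theorem actsBy_eq_refl [Finite G] {P : Sylow 2 G} (c : WreathCoords m (P : Subgroup G) κ z)
    (hm : 1 ≤ m) {n : G} {θ} (h : ActsBy κ n θ) (ha : θ (half m, 0) = (half m, 0))
    (hb : θ (0, half m) = (0, half m)) (v) : θ v = v := by
  have hθ : ∀ v, v + v = 0 → θ v = v := by
    intro v hv
    rcases eq_of_add_self hv with rfl | rfl | rfl | rfl
    · exact _root_.map_zero θ
    · exact ha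
    · exact hb
    · rw [show ((half m, half m) : ZMod (2 ^ (m + 1)) × ZMod (2 ^ (m + 1)))
        = (half m, 0) + (0, half m) by simp, _root_.map_add, ha, hb]
  have h2m : n ^ 2 ^ m ∈ Subgroup.centralizer (c.base : Set G) := by
    rw [Subgroup.mem_centralizer_iff]
    rintro _ ⟨v, rfl⟩
    have h1 := h.pow (2 ^ m) v
    rw [iterate_fix θ hθ m v (Prod.ext
      ((nsmul_eq_mul _ v.1).trans (by rw [ZMod.natCast_self, zero_mul]; rfl))
      ((nsmul_eq_mul _ v.2).trans (by rw [ZMod.natCast_self, zero_mul]; rfl)))] at h1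
    rw [mul_inv_eq_iff_eq_mul] at h1
    exact h1.symm
  obtain ⟨e, q, hq, hord⟩ := Nat.exists_eq_two_pow_mul_odd (orderOf_pos n).ne'
  have hpg : IsPGroup 2 (Subgroup.zpowers (n ^ q)) := by
    have h1 : orderOf (n ^ q) ∣ 2 ^ e := by
      rw [orderOf_dvd_iff_pow_eq_one, ← pow_mul, mul_comm, ← hord, pow_orderOf_eq_one]
    obtain ⟨k, -, hk⟩ := (Nat.dvd_prime_pow Nat.prime_two).mp h1
    exact IsPGroup.of_card ((Nat.card_zpowers _).trans hk)
  have hnorm : ∀ k : ℕ, n ^ k ∈ Subgroup.normalizer (c.base : Set G) := by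
    intro k
    refine Subgroup.pow_mem _ ?_ k
    rw [Subgroup.mem_normalizer_iff]
    intro x
    constructor
    · rintro ⟨v, rfl⟩; exact ⟨_, (h v).symm⟩
    · rintro ⟨v, hv⟩
      refine ⟨θ.symm v, ?_⟩
      rw [← h.inv v, hv]; group
  obtain ⟨Q, hQ⟩ := (hpg.to_sup_of_normal_right' (P.isPGroup'.to_le c.base_le)
    (by rw [Subgroup.zpowers_le]; exact hnorm q)).exists_le_sylow
  have hnQ : n ^ q ∈ Q := hQ (Subgroup.mem_sup_left (Subgroup.mem_zpowers _))
  have hAQ : ∀ v, κ v ∈ Q := fun v => hQ (Subgroup.mem_sup_right ⟨v, rfl⟩)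
  obtain ⟨r, d⟩ := c.conj_sylow Q
  obtain ⟨η, hη⟩ := c.exists_actsBy_of_sylow hm d (g := 1) (by simpa using hAQ)
  rw [mul_one] at hη
  have hη' : ∀ v, r * κ v * r⁻¹ = κ (η.symm v) := fun v => by simpa using hη.inv v
  have hqc : n ^ q ∈ Subgroup.centralizer (c.base : Set G) := by
    obtain ⟨w, hw | hw⟩ := (d.mem_iff _).mp hnQ
    · rw [Subgroup.mem_centralizer_iff]
      rintro _ ⟨v, rfl⟩
      rw [hw, hη']
      exact c.comm _ _
    -- If `n ^ q` were outer in `Q`, it would swap the two coordinate involutions of the base group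
    -- of `Q`, although `θ` fixes all involutions.
    · exfalso
      have h1 := d.conj_mul_z w (half m, 0)
      have h2 := h.pow q (η.symm (half m, 0))
      rw [← hw, hη', h2, hη'] at h1
      have h3 : θ^[q] (η.symm (half m, 0)) = η.symm (half m, 0) := by
        apply Function.iterate_fixed
        apply hθ
        rw [← _root_.map_add]
        simp [half_add_half]
      have h4 := congrArg Prod.fst (η.symm.injective (h3.symm.trans (c.inj h1)))
      exact half_ne_zero m h4
  have hn : n ∈ Subgroup.centralizer (c.base : Set G) := by
    have hcop : IsCoprime (q : ℤ) ((2 ^ m : ℕ) : ℤ) :=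
      Nat.isCoprime_iff_coprime.mpr (Nat.Coprime.pow_right _ (Nat.coprime_two_right.mpr hq))
    obtain ⟨a, b, hab⟩ := hcop
    have : n = (n ^ q) ^ a * (n ^ 2 ^ m) ^ b := by
      rw [← zpow_natCast n q, ← zpow_natCast n (2 ^ m), ← zpow_mul, ← zpow_mul, ← zpow_add,
        mul_comm (q : ℤ), mul_comm ((2 ^ m : ℕ) : ℤ), hab, zpow_one]
    rw [this]
    exact Subgroup.mul_mem _ (Subgroup.zpow_mem _ hqc a) (Subgroup.zpow_mem _ h2m b)
  apply c.inj
  rw [← h, ← (Subgroup.mem_centralizer_iff.mp hn) _ ⟨v, rfl⟩, mul_inv_cancel_right]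

theorem actsBy_ext [Finite G] {P : Sylow 2 G} (c : WreathCoords m (P : Subgroup G) κ z)
    (hm : 1 ≤ m) {n n' : G} {θ θ'} (h : ActsBy κ n θ) (h' : ActsBy κ n' θ')
    (ha : θ (half m, 0) = θ' (half m, 0)) (hb : θ (0, half m) = θ' (0, half m)) (v) :
    θ v = θ' v := by
  have := c.actsBy_eq_refl hm (h'.inv.mul h) (by simp [ha]) (by simp [hb]) v
  rwa [AddEquiv.trans_apply, AddEquiv.symm_apply_eq] at this

end WreathCoords

/-! ### Invariance under the automorphisms induced on the base group -/

namespace WreathCoords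

variable {G : Type*} [Group G] {m : ℕ} {S : Subgroup G}
  {κ : ZMod (2 ^ (m + 1)) × ZMod (2 ^ (m + 1)) → G} {z : G}

/-- A cyclic permutation of the involutions of the base group induced by an element of its
normalizer, if there is an element of the normalizer that moves the central involution. -/
theorem exists_actsBy_cycle (c : WreathCoords m S κ z) {n : G} {θ} (h : ActsBy κ n θ)
    (hc : θ (half m, half m) ≠ (half m, half m)) :
    ∃ n τ, ActsBy κ n τ ∧ τ (half m, 0) = (0, half m) ∧ τ (0, half m) = (half m, half m) := by
  have hh := half_add_half m
  have h0 := half_ne_zero m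
  have hne : ∀ v, v ≠ 0 → v + v = 0 → θ v = (half m, 0) ∨ θ v = (0, half m) ∨
      θ v = (half m, half m) := by
    intro v hv hv2
    refine (eq_of_add_self (v := θ v) (by rw [← _root_.map_add, hv2, _root_.map_zero])).resolve_left
      fun h => hv ?_
    rwa [EmbeddingLike.map_eq_zero_iff] at h
  have hsum : θ (half m, half m) = θ (half m, 0) + θ (0, half m) := by
    rw [← _root_.map_add]; simp
  have hsum0 : ∀ v, v = 0 → θ (half m, half m) ≠ v := by
    rintro _ rfl h
    rw [EmbeddingLike.map_eq_zero_iff] at h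
    exact h0 (congrArg Prod.fst h)
  have hs := c.actsBy_swap
  rcases hne (half m, 0) (by simp [h0]) (by simp [hh]) with ha | ha | ha <;>
  rcases hne (0, half m) (by simp [h0]) (by simp [hh]) with hb | hb | hb <;>
  rw [ha, hb] at hsum
  · exact absurd hsum (hsum0 _ (by simp [hh]))
  · simp at hsum; exact absurd hsum hc
  · exact ⟨_, _, hs.mul h, by simp [ha], by simp [hb]⟩
  · simp at hsum; exact absurd hsum hc
  · exact absurd hsum (hsum0 _ (by simp [hh]))
  · exact ⟨_, _, h, ha, hb⟩
  · refine ⟨_, _, h.mul h, by simp [ha, hsum, hh], by simp [ha, hb]⟩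
  · exact ⟨_, _, h.mul hs, by simp [hb], by simp [ha]⟩
  · exact absurd hsum (hsum0 _ (by simp [hh]))

/-- If all induced automorphisms fix the central involution, they are the identity and the swap, and
the first coordinate serves as `l`. Otherwise they include an element `τ` of order 3 and `l = s ∘ τ`
with `s v = v.1 + v.2`; the three terms are then the values of `R ∘ s` along the `τ`-orbit of `v`.
-/
theorem exists_weight [Finite G] {P : Sylow 2 G} (c : WreathCoords m (P : Subgroup G) κ z)
    (hm : 1 ≤ m) :
    ∃ l : ZMod (2 ^ (m + 1)) × ZMod (2 ^ (m + 1)) →+ ZMod (2 ^ (m + 1)),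
      l (half m, 0) = half m ∧ l (0, half m) = 0 ∧ ∀ n θ, ActsBy κ n θ → ∀ v,
        ramanujan m ((θ v).1 + (θ v).2) + ramanujan m (l (θ v)) + ramanujan m (l (θ v).swap)
          = ramanujan m (v.1 + v.2) + ramanujan m (l v) + ramanujan m (l v.swap) := by
  have hh := half_add_half m
  have h0 := half_ne_zero m
  have hs := c.actsBy_swap
  by_cases hI : ∀ n θ, ActsBy κ n θ → θ (half m, half m) = (half m, half m)
  · refine ⟨AddMonoidHom.fst _ _, rfl, rfl, fun n θ h v => ?_⟩
    have hc := hI n θ h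
    have hsum : θ (half m, half m) = θ (half m, 0) + θ (0, half m) := by
      rw [← _root_.map_add]; simp
    have ha2 : θ (half m, 0) + θ (half m, 0) = 0 := by
      rw [← _root_.map_add]; simp [hh]
    have hcases : θ (half m, 0) = (half m, 0) ∨ θ (half m, 0) = (0, half m) := by
      rcases eq_of_add_self ha2 with ha | ha | ha | ha
      · rw [EmbeddingLike.map_eq_zero_iff] at ha
        exact absurd (congrArg Prod.fst ha) h0
      · exact Or.inl ha
      · exact Or.inr ha
      · exact absurd (congrArg Prod.snd (θ.injective (ha.trans hc.symm))).symm h0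
    have hb : θ (0, half m) = (half m, half m) - θ (half m, 0) := by
      rw [← hc, hsum]; abel
    rcases hcases with ha | ha
    · rw [c.actsBy_eq_refl hm h ha (by rw [hb, ha]; simp)]
    · have := c.actsBy_ext hm h hs (by rw [ha]; rfl) (by rw [hb, ha]; simp) v
      have this : θ v = v.swap := this
      rw [this]
      simp only [AddMonoidHom.coe_fst, Prod.fst_swap, Prod.snd_swap, add_comm v.2]
      ring
  · push Not at hI
    obtain ⟨n, θ, h, hc⟩ := hI
    obtain ⟨n, τ, h, ha, hb⟩ := c.exists_actsBy_cycle h hc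
    have hc : τ (half m, half m) = (half m, 0) := by
      have : τ (half m, half m) = τ (half m, 0) + τ (0, half m) := by
        rw [← _root_.map_add]; simp
      rw [this, ha, hb]; simp [hh]
    let s : ZMod (2 ^ (m + 1)) × ZMod (2 ^ (m + 1)) →+ ZMod (2 ^ (m + 1)) :=
      AddMonoidHom.fst _ _ + AddMonoidHom.snd _ _
    have hsv : ∀ v, s v = v.1 + v.2 := fun v => rfl
    have hss : ∀ v : ZMod (2 ^ (m + 1)) × ZMod (2 ^ (m + 1)), s v.swap = s v :=
      fun v => add_comm _ _
    -- The relations of `S₃` need only be checked on involutions, by `actsBy_ext`.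
    have hτs : ∀ v, τ v.swap = (τ (τ v)).swap := fun v =>
      c.actsBy_ext hm (h.mul hs) (hs.mul (h.mul h)) (by simp [ha, hb]) (by simp [ha, hb, hc]) v
    have hτ3 : ∀ v, τ (τ (τ v)) = v := fun v =>
      c.actsBy_eq_refl hm (h.mul (h.mul h)) (by simp [ha, hb, hc]) (by simp [ha, hb, hc]) v
    let F : ZMod (2 ^ (m + 1)) × ZMod (2 ^ (m + 1)) → ℂ := fun v =>
      ramanujan m (s v) + ramanujan m (s (τ v)) + ramanujan m (s (τ v.swap))
    have hFτ : ∀ v, F (τ v) = F v := by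
      intro v
      simp only [F, hτs, hss, hτ3]; ring
    have hFs : ∀ v, F v.swap = F v := by
      intro v
      simp only [F, hτs, hss, hτ3]; ring
    refine ⟨s.comp τ.toAddMonoidHom, ?_, ?_, fun n' θ h' v => ?_⟩
    · change s (τ _) = _
      rw [ha, hsv, zero_add]
    · change s (τ _) = _
      rw [hb, hsv, hh]
    change F (θ v) = F v
    have hne : ∀ v, v ≠ 0 → v + v = 0 → θ v = (half m, 0) ∨ θ v = (0, half m) ∨
        θ v = (half m, half m) := by
      intro v hv hv2
      refine (eq_of_add_self (v := θ v)
        (by rw [← _root_.map_add, hv2, _root_.map_zero])).resolve_left fun h => hv ?_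
      rwa [EmbeddingLike.map_eq_zero_iff] at h
    have hinj : θ (half m, 0) ≠ θ (0, half m) := fun h1 =>
      h0 (congrArg Prod.fst (θ.injective h1))
    -- Each of the six permutations of the involutions is realized by a product of the swap and
    -- powers of `τ`, and `θ` agrees with that product.
    rcases hne (half m, 0) (by simp [h0]) (by simp [hh]) with ha' | ha' | ha' <;>
    rcases hne (0, half m) (by simp [h0]) (by simp [hh]) with hb' | hb' | hb'
    · exact absurd (ha'.trans hb'.symm) hinj
    · rw [c.actsBy_eq_refl hm h' ha' hb']
    · rw [c.actsBy_ext hm h' (hs.mul h) (by simp [ha, ha']) (by simp [hb, hb'])]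
      exact (hFs _).trans (hFτ v)
    · rw [c.actsBy_ext hm h' hs (by simp [ha']) (by simp [hb'])]
      exact hFs v
    · exact absurd (ha'.trans hb'.symm) hinj
    · rw [c.actsBy_ext hm h' h (by simp [ha, ha']) (by simp [hb, hb'])]
      exact hFτ v
    · rw [c.actsBy_ext hm h' (h.mul h) (by simp [ha, hb, ha']) (by simp [hb, hc, hb'])]
      exact (hFτ _).trans (hFτ v)
    · rw [c.actsBy_ext hm h' (hs.mul (h.mul h)) (by simp [ha, hb, ha']) (by simp [hb, hc, hb'])]
      exact (hFs _).trans ((hFτ _).trans (hFτ v))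
    · exact absurd (ha'.trans hb'.symm) hinj

/-! ### Elements of order 4 squaring to the central involution -/

/-- Diagonal elements are central, so they are not inverted unless their square is 1. If `h` or `k`
lies in the base group, one of the two is forced to be diagonal or `u` to centralize `h`. If both
are outer, `h * k⁻¹` is diagonal, and conjugation by `u` turns it into `h⁻¹ * k⁻¹`. -/
theorem false_of_inverting (c : WreathCoords m S κ z) {h k u v : G} (hh : h ∈ S) (hk : k ∈ S)
    (hu : u ∈ S) (hv : v ∈ S) (hhk : h * k = k * h) (h2 : h ^ 2 = k ^ 2) (h1 : h ^ 2 ≠ 1)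
    (huh : u * h * u⁻¹ = h⁻¹) (huk : u * k * u⁻¹ = k) (hvh : v * h * v⁻¹ = h)
    (hvk : v * k * v⁻¹ = k⁻¹) : False := by
  have noninv : ∀ x : G, x ^ 2 ≠ 1 → x ≠ x⁻¹ := fun x hx h =>
    hx (by rw [pow_two]; exact mul_eq_one_iff_eq_inv.mpr h)
  have hcen : ∀ w : ZMod (2 ^ (m + 1)) × ZMod (2 ^ (m + 1)), w.1 = w.2 → ∀ g ∈ S,
      g * κ w * g⁻¹ = κ w := fun w hw g hg => by
    rw [c.commute_of_diag hw hg, mul_inv_cancel_right]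
  obtain ⟨a, rfl | rfl⟩ := (c.mem_iff h).mp hh <;> obtain ⟨b, rfl | rfl⟩ := (c.mem_iff k).mp hk
  · obtain ⟨e, rfl | rfl⟩ := (c.mem_iff u).mp hu
    · rw [c.conj_base] at huh
      exact noninv _ h1 huh
    · rw [c.conj_mul_z] at huk
      have := hcen b (congrArg Prod.snd (c.inj huk)) v hv
      exact noninv _ (h2 ▸ h1) (this.symm.trans hvk)
  · have := hcen a (c.eq_diag_of_commute hhk.symm) u hu
    exact noninv _ h1 (this.symm.trans huh)
  · have := hcen b (c.eq_diag_of_commute hhk) v hv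
    exact noninv _ (h2 ▸ h1) (this.symm.trans hvk)
  · have h3 : κ a * z * (κ b * z)⁻¹ = κ (a - b) := by
      rw [mul_inv_rev, mul_assoc, mul_inv_cancel_left, ← c.map_neg, ← c.map_add, sub_eq_add_neg]
    have h4 := hcen (a - b) (c.eq_diag_of_commute (v := a) (by
      rw [← h3, mul_assoc _ _ (κ a * z), ← mul_assoc]
      have : Commute (κ a * z) (κ b * z)⁻¹ := Commute.inv_right hhk
      rw [mul_assoc, this.eq])) u hu
    rw [← h3] at h4
    have h5 : u * (κ a * z * (κ b * z)⁻¹) * u⁻¹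
        = (u * (κ a * z) * u⁻¹) * (u * (κ b * z) * u⁻¹)⁻¹ := by group
    rw [h5, huh, huk] at h4
    exact noninv _ h1 (mul_right_cancel h4).symm

theorem exists_inverting (c : WreathCoords m S κ z) {k : G} (hk : k ∈ S)
    (hk2 : k ^ 2 = κ (half m, half m)) :
    (∃ w, k = κ w ∧ w.1 = w.2) ∨ ∃ v ∈ S, v * k * v⁻¹ = k⁻¹ := by
  have hh := half_add_half m
  obtain ⟨w, rfl | rfl⟩ := (c.mem_iff k).mp hk
  · rw [c.map_sq] at hk2
    have e1 : w.1 + w.1 = half m := congrArg Prod.fst (c.inj hk2)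
    have e2 : w.2 + w.2 = half m := congrArg Prod.snd (c.inj hk2)
    have e3 : (w.1 - w.2) + (w.1 - w.2) = 0 := by linear_combination e1 - e2
    rcases eq_zero_or_half_of_add_self e3 with e4 | e4
    · exact Or.inl ⟨w, rfl, sub_eq_zero.mp e4⟩
    · refine Or.inr ⟨z, c.z_mem, ?_⟩
      rw [c.actsBy_swap, ← c.map_neg]
      congr 1
      ext
      · change w.2 = -w.1
        linear_combination e1 - e4
      · change w.1 = -w.2
        linear_combination e1 - e4
  · rw [c.sq_mul_z] at hk2
    have e1 : w.1 + w.2 = half m := congrArg Prod.fst (c.inj hk2)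
    refine Or.inr ⟨κ (half m, 0), c.base_mem _, ?_⟩
    rw [← mul_assoc, ← c.map_add, ← c.map_neg, c.mul_z_mul, c.inv_mul_z]
    congr 2
    ext
    · simp only [Prod.fst_add, Prod.fst_neg, Prod.fst_swap, Prod.snd_neg, neg_zero]
      linear_combination e1 + hh
    · simp only [Prod.snd_add, Prod.fst_neg, Prod.snd_swap, Prod.snd_neg]
      linear_combination e1

/-- Put `h = κ a * z` and `k = κ b`, so that `k` is central in `P` and some `u` in `P` inverts `h`.
If `h` and `k` were conjugate, `h` would be central in a Sylow subgroup `T` containing `k`, and some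
`v` in `T` would invert `k`. Bringing `u` and a conjugate of `v` into one Sylow subgroup contradicts
`false_of_inverting`. -/
theorem not_conj_of_sq [Finite G] {P : Sylow 2 G} (c : WreathCoords m (P : Subgroup G) κ z)
    {g : G} {a b} (ha : (κ a * z) ^ 2 = κ (half m, half m)) (hb : κ b ^ 2 = κ (half m, half m))
    (hb' : b.1 = b.2) : g * κ b * g⁻¹ ≠ κ a * z := by
  intro hg
  have h1 : κ (half m, half m) ≠ 1 := by
    rw [← c.map_zero]
    exact fun h => half_ne_zero m (congrArg Prod.fst (c.inj h))
  have hcomm : κ a * z * κ b = κ b * (κ a * z) := c.commute_of_diag hb' (c.mul_z_mem a)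
  obtain ⟨u, hu, huh⟩ := (c.exists_inverting (c.mul_z_mem a) ha).resolve_left
    fun ⟨w, hw, _⟩ => c.mul_z_ne _ _ hw
  have huk : u * κ b * u⁻¹ = κ b := by
    rw [c.commute_of_diag hb' hu, mul_inv_cancel_right]
  -- a Sylow subgroup in which `κ a * z` is central and which contains `κ b`
  obtain ⟨x, hx, T, hT1, hT2⟩ := exists_conj_into_sylow (p := 2)
    (M := Subgroup.centralizer {κ a * z}) (D := (P : Subgroup G) ⊓ Subgroup.centralizer {κ a * z})
    (E := (P : Subgroup G).map (MulAut.conj g).toMonoidHom)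
    (P.isPGroup'.to_le inf_le_left) (P.isPGroup'.map _) inf_le_right (by
      rintro _ ⟨p, hp, rfl⟩
      rw [Subgroup.mem_centralizer_singleton_iff, ← hg]
      change (MulAut.conj g) p * (MulAut.conj g) (κ b) = (MulAut.conj g) (κ b) * (MulAut.conj g) p
      rw [← _root_.map_mul, c.commute_of_diag hb' hp, _root_.map_mul])
  have hxa : x * (κ a * z) * x⁻¹ = κ a * z := by
    rw [Subgroup.mem_centralizer_singleton_iff] at hx
    rw [hx, mul_inv_cancel_right]
  have hTP : (T : Subgroup G) = (P : Subgroup G).map (MulAut.conj (x * g)).toMonoidHom := by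
    symm
    apply Subgroup.eq_of_le_of_card_ge
    · rintro _ ⟨p, hp, rfl⟩
      have := hT2 _ ⟨p, hp, rfl⟩
      have e : (MulAut.conj (x * g)).toMonoidHom p
        = x * (MulAut.conj g).toMonoidHom p * x⁻¹ := by
          simp [mul_assoc]
      rwa [e]
    · rw [Nat.card_congr ((P : Subgroup G).equivMapOfInjective
        (MulAut.conj (x * g)).toMonoidHom (MulAut.conj (x * g)).injective).symm.toEquiv,
        T.card_eq_multiplicity, P.card_eq_multiplicity]
  have d := c.map (MulAut.conj (x * g)).toMonoidHom (MulAut.conj (x * g)).injective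
  rw [← hTP] at d
  have hd : (MulAut.conj (x * g)) (κ b) = κ a * z := by
    rw [← hxa, ← hg]; simp [mul_assoc]
  have hbT : κ b ∈ T := hT1 ⟨c.base_mem b, Subgroup.mem_centralizer_singleton_iff.mpr hcomm.symm⟩
  have hcent : ∀ t ∈ T, t * (κ a * z) * t⁻¹ = κ a * z := by
    intro t ht
    have := d.commute_of_diag hb' ht
    change t * (MulAut.conj (x * g)) (κ b) = (MulAut.conj (x * g)) (κ b) * t at this
    rw [hd] at this
    rw [this, mul_inv_cancel_right]
  have hsq : (MulAut.conj (x * g)) (κ (half m, half m)) = κ (half m, half m) := by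
    rw [← hb, map_pow, hd, ha, hb]
  -- If `κ b` were diagonal in `T`, it would be `κ a * z` or its inverse, since these are the only
  -- diagonal elements of `T` with that square; but both are outer in `P`.
  rcases d.exists_inverting hbT (hb.trans hsq.symm) with ⟨w, hw, hw'⟩ | ⟨v, hv, hvk⟩
  · have hw : κ b = (MulAut.conj (x * g)) (κ w) := hw
    have e0 : κ w ^ 2 = κ b ^ 2 := by
      apply (MulAut.conj (x * g)).injective
      rw [map_pow, ← hw, map_pow, hd, ha, hb]
    rw [c.map_sq, c.map_sq] at e0
    have e1 : w.1 + w.1 = b.1 + b.1 := congrArg Prod.fst (c.inj e0)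
    have hb2 : b.1 + b.1 = half m := by
      rw [c.map_sq] at hb; exact congrArg Prod.fst (c.inj hb)
    have e2 : (w.1 - b.1) + (w.1 - b.1) = 0 := by linear_combination e1
    rcases eq_zero_or_half_of_add_self e2 with e3 | e3
    · have : w = b := Prod.ext (sub_eq_zero.mp e3) (by
        rw [← hw', ← hb']; exact sub_eq_zero.mp e3)
      rw [this, hd] at hw
      exact c.mul_z_ne _ _ hw.symm
    · have e4 : w.1 = -b.1 := by linear_combination e3 + hb2 + half_add_half m
      have : w = -b := Prod.ext e4 (by rw [← hw', e4, hb']; rfl)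
      rw [this, c.map_neg, map_inv, hd, c.inv_mul_z] at hw
      exact c.mul_z_ne _ _ hw.symm
  -- `M` consists of the elements that centralize or invert each of `κ a * z` and `κ b`; it contains
  -- `u` and `v`.
  · let M : Subgroup G :=
      { carrier := {y | (y * (κ a * z) * y⁻¹ = κ a * z ∨ y * (κ a * z) * y⁻¹ = (κ a * z)⁻¹) ∧
          (y * κ b * y⁻¹ = κ b ∨ y * κ b * y⁻¹ = (κ b)⁻¹)}
        one_mem' := by simp
        mul_mem' := by
          have key : ∀ t y y' : G, (y * t * y⁻¹ = t ∨ y * t * y⁻¹ = t⁻¹) →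
              (y' * t * y'⁻¹ = t ∨ y' * t * y'⁻¹ = t⁻¹) →
              (y * y' * t * (y * y')⁻¹ = t ∨ y * y' * t * (y * y')⁻¹ = t⁻¹) := by
            intro t y y' h h'
            have e : y * y' * t * (y * y')⁻¹ = y * (y' * t * y'⁻¹) * y⁻¹ := by group
            rw [e]
            rcases h' with h' | h' <;> rw [h']
            · exact h
            · rw [← conj_inv]
              rcases h with h | h <;> rw [h]
              · exact Or.inr rfl
              · exact Or.inl (inv_inv t)
          intro _ _ h h'; exact ⟨key _ _ _ h.1 h'.1, key _ _ _ h.2 h'.2⟩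
        inv_mem' := by
          have key : ∀ t y : G, (y * t * y⁻¹ = t ∨ y * t * y⁻¹ = t⁻¹) →
              (y⁻¹ * t * y⁻¹⁻¹ = t ∨ y⁻¹ * t * y⁻¹⁻¹ = t⁻¹) := by
            rintro t y (h | h)
            · left
              conv_lhs => rw [← h]
              group
            · right
              have : t = y * t⁻¹ * y⁻¹ := by rw [← conj_inv, h, inv_inv]
              conv_lhs => rw [this]
              group
          intro _ h; exact ⟨key _ _ h.1, key _ _ h.2⟩ }
    obtain ⟨y, hy, Q, hQ1, hQ2⟩ := exists_conj_into_sylow (p := 2)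
      (M := M) (D := (P : Subgroup G) ⊓ M) (E := (T : Subgroup G) ⊓ M)
      (P.isPGroup'.to_le inf_le_left) (T.isPGroup'.to_le inf_le_left) inf_le_right inf_le_right
    have hyv := hQ2 v ⟨hv, Or.inl (hcent v hv), Or.inr hvk⟩
    obtain ⟨r, q⟩ := c.conj_sylow Q
    -- Because `y` at most inverts `t`, the conjugate `y * v * y⁻¹` acts on `t` exactly as `v` does.
    have key : ∀ t : G, (y * t * y⁻¹ = t ∨ y * t * y⁻¹ = t⁻¹) →
        (v * t * v⁻¹ = t → y * v * y⁻¹ * t * (y * v * y⁻¹)⁻¹ = t) ∧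
        (v * t * v⁻¹ = t⁻¹ → y * v * y⁻¹ * t * (y * v * y⁻¹)⁻¹ = t⁻¹) := by
      intro t ht
      obtain ⟨t', ht', hyt, hyt'⟩ : ∃ t', (t' = t ∨ t' = t⁻¹) ∧ y * t' * y⁻¹ = t ∧
          y * t'⁻¹ * y⁻¹ = t⁻¹ := by
        rcases ht with ht | ht
        · exact ⟨t, Or.inl rfl, ht, by rw [← conj_inv, ht]⟩
        · exact ⟨t⁻¹, Or.inr rfl, by rw [← conj_inv, ht, inv_inv], by rw [inv_inv, ht]⟩
      have e : y * v * y⁻¹ * t * (y * v * y⁻¹)⁻¹ = y * (v * t' * v⁻¹) * y⁻¹ := by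
        conv_lhs => rw [← hyt]
        group
      rw [e]
      constructor
      · intro h
        have : v * t' * v⁻¹ = t' := by
          rcases ht' with rfl | rfl
          · exact h
          · rw [← conj_inv, h]
        rw [this, hyt]
      · intro h
        have : v * t' * v⁻¹ = t'⁻¹ := by
          rcases ht' with rfl | rfl
          · exact h
          · rw [← conj_inv, h]
        rw [this, hyt']
    refine q.false_of_inverting (h := κ a * z) (k := κ b) (u := u) (v := y * v * y⁻¹)
      (hQ1 ⟨c.mul_z_mem a, ?_, ?_⟩) (hQ1 ⟨c.base_mem b, ?_, ?_⟩)
      (hQ1 ⟨hu, Or.inr huh, Or.inl huk⟩) hyv hcomm (ha.trans hb.symm) (ha ▸ h1) huh huk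
      ((key _ hy.1).1 (hcent v hv)) ((key _ hy.2).2 hvk)
    · left; group
    · left; rw [hcomm, mul_inv_cancel_right]
    · left; rw [← hcomm, mul_inv_cancel_right]
    · left; group

end WreathCoords

/-! ### Wreathed Sylow subgroups and conclusion -/

theorem exists_isEffectiveCharacter_of_wreathed {G : Type*} [Group G] [Finite G]
    (hrk : rk G = 2) (P : Sylow 2 G) (hP : IsWreathedTwoGroup P) :
    ∃ χ : P → ℂ, IsEffectiveCharacter 2 P χ := by
  have := Fintype.ofFinite P
  obtain ⟨m, hm, κ, z, c⟩ := exists_wreathCoords hP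
  have hh := half_add_half m
  have h0 := half_ne_zero m
  have d : WreathCoords m (P : Subgroup G) (fun v => (κ v : G)) (z : G) := by
    have := c.map (P : Subgroup G).subtype (P : Subgroup G).subtype_injective
    rwa [← MonoidHom.range_eq_map, Subgroup.range_subtype] at this
  obtain ⟨l, hla, hlb, hl⟩ := d.exists_weight hm
  obtain ⟨χ, h1, h2⟩ := c.exists_fun
    (fun v => Fintype.card P *
      (ramanujan m (v.1 + v.2) + ramanujan m (l v) + ramanujan m (l v.swap)))
    (fun v => -(Fintype.card P * ramanujan m (v.1 + v.2)))
  have hall : ∀ g : P, ∃ v, g = κ v ∨ g = κ v * z :=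
    fun g => (c.mem_iff g).mp (Subgroup.mem_top g)
  have hlc : l (half m, half m) = half m := by
    rw [show ((half m, half m) : ZMod (2 ^ (m + 1)) × ZMod (2 ^ (m + 1)))
      = (half m, 0) + (0, half m) by simp, map_add, hla, hlb, add_zero]
  have hinv : ∀ v, v ≠ 0 → v + v = 0 → χ (κ v) = -Fintype.card P := by
    intro v hv hv2
    rw [h1]
    rcases WreathCoords.eq_of_add_self hv2 with rfl | rfl | rfl | rfl
    · exact absurd rfl hv
    · simp [hla, hlb, ramanujan_half, ramanujan_zero]
    · simp [hla, hlb, ramanujan_half, ramanujan_zero]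
    · simp [hlc, hh, ramanujan_half, ramanujan_zero]
  -- elements of the base group that are conjugate in `G`
  have hbase : ∀ v w (g : G), g * κ v * g⁻¹ = κ w → χ (κ v) = χ (κ w) := by
    intro v w g hg
    obtain ⟨n, θ, hn, rfl⟩ := d.exists_actsBy_of_fusion hm hg
    rw [h1, h1, hl n θ hn]
  -- The only diagonal involution is `(half m, half m)`, so fusion between diagonal elements
  -- preserves it.
  have hdiag : ∀ a b (g : G), g * κ a * g⁻¹ = κ b → a.1 = a.2 → b.1 = b.2 →
      (a = 0 ↔ b = 0) ∧ (a = (half m, half m) → b = (half m, half m)) := by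
    intro a b g hg ha hb
    obtain ⟨n, θ, hn, rfl⟩ := d.exists_actsBy_of_fusion hm hg
    refine ⟨(EmbeddingLike.map_eq_zero_iff (f := θ)).symm, fun h => ?_⟩
    have h4 : θ a + θ a = 0 := by rw [← map_add, h]; simp [hh]
    rcases WreathCoords.eq_of_add_self h4 with h5 | h5 | h5 | h5
    · rw [EmbeddingLike.map_eq_zero_iff, h] at h5
      exact absurd (congrArg Prod.fst h5) h0
    · rw [h5] at hb; exact absurd hb h0
    · rw [h5] at hb; exact absurd hb.symm h0
    · exact h5
  have hsq : ∀ v, (κ v * z) ^ 2 = κ (v.1 + v.2, v.1 + v.2) := fun v => by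
    rw [c.sq_mul_z]; congr 1; ext
    · rfl
    · exact add_comm _ _
  have houter : ∀ v w (g : G), g * (κ v * z : P) * g⁻¹ = (κ w * z : P) →
      χ (κ v * z) = χ (κ w * z) := by
    intro v w g hg
    have e1 : g * κ (v.1 + v.2, v.1 + v.2) * g⁻¹ = κ (w.1 + w.2, w.1 + w.2) := by
      rw [← hsq, ← hsq, Subgroup.coe_pow, Subgroup.coe_pow, ← hg, conj_pow]
    have e2 : g⁻¹ * κ (w.1 + w.2, w.1 + w.2) * g⁻¹⁻¹ = κ (v.1 + v.2, v.1 + v.2) := by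
      rw [← e1]; group
    obtain ⟨f1, f2⟩ := hdiag _ _ g e1 rfl rfl
    obtain ⟨-, f3⟩ := hdiag _ _ g⁻¹ e2 rfl rfl
    rw [h2, h2]
    have f1 : v.1 + v.2 = 0 ↔ w.1 + w.2 = 0 := by simpa [Prod.ext_iff] using f1
    have f2 : v.1 + v.2 = half m → w.1 + w.2 = half m := by simpa [Prod.ext_iff] using f2
    have f3 : w.1 + w.2 = half m → v.1 + v.2 = half m := by simpa [Prod.ext_iff] using f3
    simp only [ramanujan, f1, show v.1 + v.2 = half m ↔ w.1 + w.2 = half m from ⟨f2, f3⟩]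
  have hmix : ∀ v w (g : G), g * κ w * g⁻¹ = (κ v * z : P) → χ (κ v * z) = χ (κ w) := by
    intro v w g hg
    have e1 : g * κ (w + w) * g⁻¹ = κ (v.1 + v.2, v.1 + v.2) := by
      rw [← hsq, Subgroup.coe_pow, ← hg, ← c.map_sq, Subgroup.coe_pow, conj_pow]
    obtain ⟨n, θ, hn, hθ⟩ := d.exists_actsBy_of_fusion hm e1
    -- replace `κ w` by a conjugate with the same square as `κ v * z`
    have hw : χ (κ w) = χ (κ (θ w)) := hbase w (θ w) n (hn w)
    have hg' : (g * n⁻¹) * κ (θ w) * (g * n⁻¹)⁻¹ = (κ v * z : P) := by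
      have hnw : n * κ w * n⁻¹ = κ (θ w) := hn w
      rw [← hnw, ← hg]; group
    rw [map_add] at hθ
    rw [hw]
    generalize θ w = u at hθ hg'
    have f1 : u.1 + u.1 = v.1 + v.2 := congrArg Prod.fst hθ
    have f2 : u.2 + u.2 = v.1 + v.2 := congrArg Prod.snd hθ
    by_cases hv : (v.1 + v.2) + (v.1 + v.2) = 0
    -- With `t = v.1 + v.2`, the element `κ v * z` squares to `κ (t, t)`. If `t = 0`, both elements
    -- are involutions with value `-|P|`. If `t = half m`, then `u.1 - u.2` is 0, which
    -- `not_conj_of_sq` excludes, or `half m`, and then both values are `|P|`. Otherwise `t + t ≠ 0`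
    -- and both values vanish.
    · rcases eq_zero_or_half_of_add_self hv with hv | hv
      · rw [hinv u, h2, hv, ramanujan_zero, mul_one]
        · rintro rfl
          rw [c.map_zero, Subgroup.coe_one, mul_one, mul_inv_cancel] at hg'
          have : κ v * z = κ 0 := by rw [c.map_zero]; exact Subtype.ext hg'.symm
          exact c.mul_z_ne _ _ this
        · rw [hθ, hv]; rfl
      · rw [hv] at f1 f2
        have f3 : (u.1 - u.2) + (u.1 - u.2) = 0 := by linear_combination f1 - f2
        rcases eq_zero_or_half_of_add_self f3 with f4 | f4
        · refine absurd hg' (d.not_conj_of_sq (a := v) ?_ ?_ (sub_eq_zero.mp f4))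
          · have := congrArg Subtype.val (hsq v)
            rwa [hv] at this
          · have := congrArg Subtype.val (c.map_sq u)
            rwa [hθ, hv] at this
        · have f5 : u.1 + u.2 = 0 := by linear_combination f1 - f4
          have f6 : l u + l u = half m := by rw [← map_add, hθ, hv, hlc]
          have f7 : l u.swap + l u.swap = half m := by
            rw [← map_add, ← Prod.swap_add, hθ, hv]; exact hlc
          rw [h1, h2, hv, f5, ramanujan_eq_zero (v := l u) (by rw [f6]; exact h0),
            ramanujan_eq_zero (v := l u.swap) (by rw [f7]; exact h0), ramanujan_half, ramanujan_zero]
          ring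
    -- From `l (half m, half m) = half m` it follows that `l (1, 1)` is odd, hence a unit, so `l` is
    -- injective on the diagonal.
    · have hlt : ∀ t, t + t ≠ 0 → l (t, t) + l (t, t) = 0 → False := by
        intro t ht hlt
        obtain ⟨k, rfl⟩ := ZMod.natCast_zmod_surjective t
        have g1 : l ((k : ZMod (2 ^ (m + 1))), (k : ZMod (2 ^ (m + 1)))) = k * l (1, 1) := by
          rw [← nsmul_eq_mul, ← map_nsmul]; simp
        have g2 : half m * l (1, 1) = half m := by
          rw [half, ← nsmul_eq_mul, ← map_nsmul]; simpa [half] using hlc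
        rw [g1] at hlt
        obtain ⟨b, hb⟩ := ZMod.natCast_zmod_surjective (l (1, 1))
        rw [← hb] at g2 hlt
        rcases Nat.even_or_odd' b with ⟨q, rfl | rfl⟩
        · apply h0
          rw [← g2]; push_cast
          linear_combination (q : ZMod (2 ^ (m + 1))) * hh
        · apply ht
          have h5 : IsUnit (((2 * q + 1 : ℕ) : ZMod (2 ^ (m + 1)))) :=
            (ZMod.isUnit_iff_coprime _ _).mpr (Nat.Coprime.pow_right _ (by simp))
          rw [← add_mul] at hlt
          exact h5.mul_left_eq_zero.mp hlt
      have f5 : (u.1 + u.2) + (u.1 + u.2) ≠ 0 := by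
        rwa [add_add_add_comm, f1, f2]
      have f6 : l u + l u + (l u + l u) ≠ 0 := by
        rw [← map_add, hθ]; exact fun h => hlt _ hv h
      have f7 : l u.swap + l u.swap + (l u.swap + l u.swap) ≠ 0 := by
        rw [← map_add, ← Prod.swap_add, hθ]; exact fun h => hlt _ hv h
      have dbl : ∀ t : ZMod (2 ^ (m + 1)), t + t + (t + t) ≠ 0 → t + t ≠ 0 := by
        intro t ht h; exact ht (by rw [h, add_zero])
      rw [h1, h2, ramanujan_eq_zero hv, ramanujan_eq_zero f5, ramanujan_eq_zero (dbl _ f6),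
        ramanujan_eq_zero (dbl _ f7)]
      ring
  refine ⟨χ, isEffectiveCharacter_of_values hrk P (c.isCharacter l h1 h2) (m := Fintype.card P)
    (fun g k hgk => ?_) ?_ fun g hg hg1 => ?_⟩
  · obtain ⟨x, hx⟩ := isConj_iff.mp hgk
    obtain ⟨v, rfl | rfl⟩ := hall g <;> obtain ⟨w, rfl | rfl⟩ := hall k
    · exact hbase _ _ _ hx
    · exact (hmix _ _ _ hx).symm
    · exact hmix _ _ x⁻¹ (by rw [← hx]; group)
    · exact houter _ _ _ hx
  · rw [← c.map_zero, h1]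
    simp [ramanujan_zero]; ring
  · obtain ⟨v, rfl | rfl⟩ := hall g
    · rw [c.map_sq, ← c.map_zero] at hg
      exact hinv v (fun h => hg1 (by rw [h, c.map_zero])) (c.inj hg)
    · rw [hsq, ← c.map_zero] at hg
      have : v.1 + v.2 = 0 := congrArg Prod.fst (c.inj hg)
      rw [h2, this, ramanujan_zero, mul_one]

end EffChar

theorem mainTheorem6 {G : Type*} [Group G] [Finite G] (hrk : EffChar.rk G = 2) (P : Sylow 2 G) :
    ((EffChar.IsDihedralTwoGroup P ∨ EffChar.IsSemidihedralTwoGroup P ∨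
        EffChar.IsWreathedTwoGroup P) →
      ∃ χ : P → ℂ, EffChar.IsEffectiveCharacter 2 P χ) ∧
    ((EffChar.IsDihedralTwoGroup P ∨ EffChar.IsSemidihedralTwoGroup P) →
      ∃ χ : P → ℂ, EffChar.IsEffectiveCharacter 2 P χ ∧
        ∀ g h : P, orderOf g = orderOf h → χ g = χ h) := by
  have key : (EffChar.IsDihedralTwoGroup P ∨ EffChar.IsSemidihedralTwoGroup P) →
      ∃ χ : P → ℂ, EffChar.IsEffectiveCharacter 2 P χ ∧
        ∀ g h : P, orderOf g = orderOf h → χ g = χ h := by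
    rintro (h | h)
    · exact EffChar.exists_isEffectiveCharacter_of_dihedral hrk P h
    · exact EffChar.exists_isEffectiveCharacter_of_semidihedral hrk P h
  refine ⟨?_, key⟩
  rintro (h | h | h)
  · exact (key (Or.inl h)).imp fun _ hχ => hχ.1
  · exact (key (Or.inr h)).imp fun _ hχ => hχ.1
  · exact EffChar.exists_isEffectiveCharacter_of_wreathed hrk P h
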